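/- Let $I=[0,1]$ and let $\tau:I\to I$ be piecewise monotonic with associated partition $C=\{a_0,\dots,a_n\}$, i.e. $0=a_0<a_1<\dots<a_n=1$ and $\tau|_{(a_{i-1},a_i)}$ is continuous and strictly monotonic for $1\le i\le n$ (the partition need not be maximal). For $x\in I$ let $\widehat\tau(x)$ be the set of left and right limits of $\tau$ at $x$ (only the right limit at $0$ and only the left limit at $1$). For $A\subset I$ put $\widehat\tau(A)=\bigcup_{x\in A}\widehat\tau(x)$ and $\widehat\tau^{-1}(A)=\{x\in I:\widehat\tau(x)\cap A\neq\emptyset\}$. Let $I_1$ be the smallest subset of $I$ that contains $C$ and is closed under $\widehat\tau$ and $\widehat\tau^{-1}$, and let $I_0=I\setminus I_1$. Let $X$ be the totally ordered set obtained from $I$ by replacing each point $x\in I_1\setminus\{0,1\}$ by two points $x^-<x^+$, with the order topology. Let $\pi:X\to I$ be the collapse map ($\pi(x^\pm)=x$, and $\pi(x)=x$ for the points that are not doubled), and let $X_0=\pi^{-1}(I_0)$. The local homeomorphism associated with $\tau$ is the unique continuous map $\sigma:X\to X$ with $\pi\circ\sigma=\tau\circ\pi$ on $X_0$. The following are equivalent.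 1. $\tau$ is transitive: viewing $\tau$ as undefined on $C$, for all non-empty open $U,V\subset I$ there is $n\ge 0$ with $\tau^n(U)\cap V\neq\emptyset$. (Here $\tau^n(U)$ is the set of all $\tau^n(x)$ with $x\in U$ and $x,\tau(x),\dots,\tau^{n-1}(x)\notin C$.) 2. $\tau$ is strongly transitive: for every non-empty open $U\subset I$ there is $n\ge 0$ with $\bigcup_{k=0}^n\widehat\tau^{\,k}(U)=I$. 3. $\sigma$ is transitive: for all non-empty open $U,V\subset X$ there is $n\ge 0$ with $\sigma^n(U)\cap V\neq\emptyset$. 4. $\sigma$ is strongly transitive: for every non-empty open $U\subset X$ there is $n\ge 0$ with $\bigcup_{k=0}^n\sigma^k(U)=X$. -/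

import Mathlib

open Set Filter Topology

/-! ## Piecewise monotonic maps of the unit interval -/

/-- A partition `0 = a 0 < a 1 < ... < a n = 1` associated with `τ : [0,1] → [0,1]`: on each open
interval `(a (i-1), a i)` the map `τ` is continuous and strictly monotonic (increasing or
decreasing).  The map `τ` is piecewise monotonic if it has such a partition.  The partition is not
assumed to be maximal.  (Note that `n ≥ 1` is automatic.) -/
structure MonotonicityPartition (τ : unitInterval → unitInterval) where
  n : ℕ
  a : Fin (n + 1) → unitInterval
  strictMono : StrictMono a
  first : a 0 = 0
  last : a (Fin.last n) = 1
  continuousOn : ∀ i : Fin n, ContinuousOn τ (Ioo (a i.castSucc) (a i.succ))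
  monotonic : ∀ i : Fin n, StrictMonoOn τ (Ioo (a i.castSucc) (a i.succ)) ∨
    StrictAntiOn τ (Ioo (a i.castSucc) (a i.succ))

/-- The multivalued map `τ̂`: `hatMap τ x` is the set of left and right limits of `τ` at `x`
(only the right limit at `0`, only the left limit at `1`). -/
def hatMap (τ : unitInterval → unitInterval) (x : unitInterval) : Set unitInterval :=
  {y | ((𝓝[<] x).NeBot ∧ Tendsto τ (𝓝[<] x) (𝓝 y)) ∨
    ((𝓝[>] x).NeBot ∧ Tendsto τ (𝓝[>] x) (𝓝 y))}

/-- `τ̂(A)`, the union of the sets `τ̂(x)` over `x ∈ A`. -/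
def hatImage (τ : unitInterval → unitInterval) (A : Set unitInterval) : Set unitInterval :=
  ⋃ x ∈ A, hatMap τ x

/-- `τ̂⁻¹(A)`, the set of `x` with `τ̂(x) ∩ A ≠ ∅`. -/
def hatPreimage (τ : unitInterval → unitInterval) (A : Set unitInterval) : Set unitInterval :=
  {x | (hatMap τ x ∩ A).Nonempty}

/-! ## Disconnecting the interval -/

/-- The disconnection of `[0,1]` at the points of `S`: a copy of `[0,1]`, with each point `x` of
`S \ {0,1}` replaced by two points `x⁻ = (x, false) < x⁺ = (x, true)`; every other point `x` is
represented by `(x, false)` only. -/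
def Disconnection (S : Set unitInterval) : Type :=
  {p : unitInterval ×ₗ Bool // (ofLex p).2 = true → (ofLex p).1 ∈ S \ {0, 1}}

namespace Disconnection

variable {S : Set unitInterval}

/-- The (total) order on the disconnection is the lexicographic one. -/
noncomputable instance : LinearOrder (Disconnection S) :=
  inferInstanceAs (LinearOrder {p : unitInterval ×ₗ Bool //
    (ofLex p).2 = true → (ofLex p).1 ∈ S \ {0, 1}})

/-- The disconnection carries the order topology. -/
noncomputable instance : TopologicalSpace (Disconnection S) := Preorder.topology _

instance : OrderTopology (Disconnection S) := ⟨rfl⟩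

/-- The collapse map `π`. -/
def collapse (x : Disconnection S) : unitInterval := (ofLex x.1).1

theorem lt_of_collapse_lt {x y : Disconnection S} (h : x.collapse < y.collapse) : x < y :=
  Prod.Lex.lt_iff.2 (Or.inl h)

theorem collapse_mono {x y : Disconnection S} (h : x ≤ y) : x.collapse ≤ y.collapse :=
  not_lt.1 fun h' => (lt_of_collapse_lt h').not_ge h

open Classical in
/-- An auxiliary section of the collapse map: the lower (`b = false`) or the upper (`b = true`)
point over `y`. -/
noncomputable def ptOver (S : Set unitInterval) (y : unitInterval) (b : Bool) : Disconnection S :=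
  if h : y ∈ S \ {0, 1} then ⟨toLex (y, b), fun _ => by simpa using h⟩
  else ⟨toLex (y, false), fun h' => absurd h' (by simp)⟩

theorem ptOver_of_mem {y : unitInterval} (h : y ∈ S \ {0, 1}) (b : Bool) :
    (ptOver S y b).1 = toLex (y, b) := congrArg Subtype.val (dif_pos h)

theorem ptOver_of_notMem {y : unitInterval} (h : y ∉ S \ {0, 1}) (b : Bool) :
    (ptOver S y b).1 = toLex (y, false) := congrArg Subtype.val (dif_neg h)

theorem ptOver_false (y : unitInterval) : (ptOver S y false).1 = toLex (y, false) := by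
  by_cases h : y ∈ S \ {0, 1}
  · exact ptOver_of_mem h false
  · exact ptOver_of_notMem h false

@[simp] theorem collapse_ptOver (y : unitInterval) (b : Bool) : (ptOver S y b).collapse = y := by
  unfold collapse
  by_cases h : y ∈ S \ {0, 1}
  · rw [ptOver_of_mem h]; rfl
  · rw [ptOver_of_notMem h]; rfl

theorem ptOver_false_le (c : Disconnection S) : ptOver S c.collapse false ≤ c := by
  change (ptOver S c.collapse false).1 ≤ c.1
  rw [ptOver_false]
  exact Prod.Lex.le_iff.2 (Or.inr ⟨rfl, Bool.false_le _⟩)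

theorem le_ptOver_true (c : Disconnection S) : c ≤ ptOver S c.collapse true := by
  change c.1 ≤ (ptOver S c.collapse true).1
  by_cases h : c.collapse ∈ S \ {0, 1}
  · rw [ptOver_of_mem h]
    exact Prod.Lex.le_iff.2 (Or.inr ⟨rfl, Bool.le_true _⟩)
  · rw [ptOver_of_notMem h]
    refine Prod.Lex.le_iff.2 (Or.inr ⟨rfl, ?_⟩)
    have h2 : (ofLex c.1).2 = false := by
      by_contra h'
      exact h (c.2 (by simpa using h'))
    change (ofLex c.1).2 ≤ false
    rw [h2]

theorem ptOver_eq_of_notMem {y : unitInterval} (h : y ∉ S \ {0, 1}) (b b' : Bool) :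
    ptOver S y b = ptOver S y b' :=
  Subtype.ext ((ptOver_of_notMem h b).trans (ptOver_of_notMem h b').symm)

theorem eq_ptOver (x : Disconnection S) :
    x = ptOver S x.collapse false ∨ x = ptOver S x.collapse true := by
  by_cases h : x.collapse ∈ S \ {0, 1}
  · cases hb : (ofLex x.1).2
    · exact Or.inl (Subtype.ext ((congrArg toLex
        (Prod.ext rfl hb : ofLex x.1 = (x.collapse, false))).trans (ptOver_of_mem h false).symm))
    · exact Or.inr (Subtype.ext ((congrArg toLex
        (Prod.ext rfl hb : ofLex x.1 = (x.collapse, true))).trans (ptOver_of_mem h true).symm))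
  · left
    apply le_antisymm _ (ptOver_false_le x)
    rw [ptOver_eq_of_notMem h false true]
    exact le_ptOver_true x

theorem eq_ptOver_of_notMem (x : Disconnection S) (h : x.collapse ∉ S \ {0, 1}) (b : Bool) :
    x = ptOver S x.collapse b := by
  rcases eq_ptOver x with h' | h'
  · rwa [ptOver_eq_of_notMem h b false]
  · rwa [ptOver_eq_of_notMem h b true]

theorem continuous_collapse : Continuous (collapse : Disconnection S → unitInterval) := by
  rw [OrderTopology.topology_eq_generate_intervals (α := unitInterval), continuous_generateFrom_iff]
  rintro _ ⟨a, rfl | rfl⟩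
  · have : collapse ⁻¹' (Ioi a) = Ioi (ptOver S a true) := by
      ext x
      refine ⟨fun h => lt_of_collapse_lt (by simpa using h), fun h => ?_⟩
      by_contra h'
      have h1 : x.collapse = a :=
        le_antisymm (not_lt.1 h') (by simpa using collapse_mono (le_of_lt h))
      exact absurd (le_ptOver_true x) (not_le.2 (h1 ▸ h))
    rw [this]; exact isOpen_Ioi
  · have : collapse ⁻¹' (Iio a) = Iio (ptOver S a false) := by
      ext x
      refine ⟨fun h => lt_of_collapse_lt (by simpa using h), fun h => ?_⟩
      by_contra h'
      have h1 : x.collapse = a :=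
        le_antisymm (by simpa using collapse_mono (le_of_lt h)) (not_lt.1 h')
      exact absurd (ptOver_false_le x) (not_le.2 (h1 ▸ h))
    rw [this]; exact isOpen_Iio

/-- Convergence to the upper point ptOver `v`. -/
theorem tendsto_ptOver_true {α : Type*} {l : Filter α} {f : α → Disconnection S} {v : unitInterval}
    (h : Tendsto (fun z => (f z).collapse) l (𝓝[>] v)) : Tendsto f l (𝓝 (ptOver S v true)) := by
  rw [tendsto_nhdsWithin_iff] at h
  refine tendsto_order.2 ⟨fun c hc => ?_, fun c hc => ?_⟩
  · filter_upwards [h.2] with z hz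
    exact hc.trans (lt_of_collapse_lt (by simpa using hz))
  · have : v < c.collapse := by
      refine lt_of_le_of_ne (by simpa using collapse_mono hc.le) fun h' => ?_
      subst h'
      exact absurd (le_ptOver_true c) (not_le.2 hc)
    filter_upwards [h.1.eventually_lt_const this] with z hz
    exact lt_of_collapse_lt hz

/-- Convergence to the lower point ptOver `v`. -/
theorem tendsto_ptOver_false {α : Type*} {l : Filter α} {f : α → Disconnection S} {v : unitInterval}
    (h : Tendsto (fun z => (f z).collapse) l (𝓝[<] v)) : Tendsto f l (𝓝 (ptOver S v false)) := by
  rw [tendsto_nhdsWithin_iff] at h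
  refine tendsto_order.2 ⟨fun c hc => ?_, fun c hc => ?_⟩
  · have : c.collapse < v := by
      refine lt_of_le_of_ne (by simpa using collapse_mono hc.le) fun h' => ?_
      subst h'
      exact absurd (ptOver_false_le c) (not_le.2 hc)
    filter_upwards [h.1.eventually_const_lt this] with z hz
    exact lt_of_collapse_lt hz
  · filter_upwards [h.2] with z hz
    exact (lt_of_collapse_lt (by simpa using hz)).trans hc

/-- Convergence to a point that is not doubled. -/
theorem tendsto_ptOver_of_notMem {α : Type*} {l : Filter α} {f : α → Disconnection S}
    {v : unitInterval} (hv : v ∉ S \ {0, 1}) (b : Bool)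
    (h : Tendsto (fun z => (f z).collapse) l (𝓝 v)) : Tendsto f l (𝓝 (ptOver S v b)) := by
  refine tendsto_order.2 ⟨fun c hc => ?_, fun c hc => ?_⟩
  · have : c.collapse < v := by
      refine lt_of_le_of_ne (by simpa using collapse_mono hc.le) fun h' => ?_
      subst h'
      exact absurd (ptOver_false_le c) (not_le.2 (ptOver_eq_of_notMem hv b false ▸ hc))
    filter_upwards [h.eventually_const_lt this] with z hz
    exact lt_of_collapse_lt hz
  · have : v < c.collapse := by
      refine lt_of_le_of_ne (by simpa using collapse_mono hc.le) fun h' => ?_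
      subst h'
      exact absurd (le_ptOver_true c) (not_le.2 (ptOver_eq_of_notMem hv b true ▸ hc))
    filter_upwards [h.eventually_lt_const this] with z hz
    exact lt_of_collapse_lt hz

theorem dense_compl_of_countable (hS : S.Countable) : Dense Sᶜ := by
  rw [dense_iff_exists_between]
  intro a b hab
  by_contra! h
  have h1 : Ioo a b ⊆ S := fun z hz => by
    by_contra hzS
    exact (h z hzS hz.1).not_gt hz.2
  have h2 : Ioo (a : ℝ) (b : ℝ) ⊆ Subtype.val '' (Ioo a b) := fun z hz =>
    ⟨⟨z, a.2.1.trans hz.1.le, hz.2.le.trans b.2.2⟩, ⟨hz.1, hz.2⟩, rfl⟩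
  have h3 := Cardinal.Real.Ioo_countable_iff.1 (((hS.mono h1).image Subtype.val).mono h2)
  exact absurd hab (not_lt.2 h3)

/-- The undoubled part of the disconnection is dense when `S` is countable. -/
theorem dense_preimage_compl (hS : S.Countable) :
    Dense ((collapse : Disconnection S → unitInterval) ⁻¹' Sᶜ) := by
  have hd := dense_compl_of_countable hS
  have up : ∀ t : unitInterval, t ≠ 1 →
      ptOver S t true ∈ closure ((collapse : Disconnection S → unitInterval) ⁻¹' Sᶜ) := by
    intro t ht
    refine mem_closure_of_frequently_of_tendsto (b := 𝓝[>] t) (f := fun s => ptOver S s false) ?_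
      (tendsto_ptOver_true (by simp only [collapse_ptOver]; exact tendsto_id))
    rw [frequently_iff]
    intro U hU
    obtain ⟨u, hu, hUu⟩ := (mem_nhdsGT_iff_exists_Ioo_subset'
      (lt_of_le_of_ne unitInterval.le_one' ht)).1 hU
    obtain ⟨s, hs, hs'⟩ := hd.exists_between hu
    exact ⟨s, hUu hs', by simpa using hs⟩
  have down : ∀ t : unitInterval, t ≠ 0 →
      ptOver S t false ∈ closure ((collapse : Disconnection S → unitInterval) ⁻¹' Sᶜ) := by
    intro t ht
    refine mem_closure_of_frequently_of_tendsto (b := 𝓝[<] t) (f := fun s => ptOver S s false) ?_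
      (tendsto_ptOver_false (by simp only [collapse_ptOver]; exact tendsto_id))
    rw [frequently_iff]
    intro U hU
    obtain ⟨u, hu, hUu⟩ := (mem_nhdsLT_iff_exists_Ioo_subset'
      (lt_of_le_of_ne unitInterval.nonneg' (Ne.symm ht))).1 hU
    obtain ⟨s, hs, hs'⟩ := hd.exists_between hu
    exact ⟨s, hUu hs', by simpa using hs⟩
  intro x
  by_cases hx0 : x.collapse = 0
  · rw [eq_ptOver_of_notMem x (by simp [hx0]) true]
    exact up _ (by simp [hx0])
  by_cases hx1 : x.collapse = 1
  · rw [eq_ptOver_of_notMem x (by simp [hx1]) false]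
    exact down _ hx0
  rcases eq_ptOver x with h | h
  · rw [h]; exact down _ hx0
  · rw [h]; exact up _ hx1

end Disconnection

namespace MonotonicityPartition

variable {τ : unitInterval → unitInterval}

/-- The set `C` of endpoints of the intervals of monotonicity. -/
def C (P : MonotonicityPartition τ) : Set unitInterval := range P.a

/-- The generalized orbit `I₁` of `C`: the smallest subset of `[0,1]` that contains `C` and is
closed under `τ̂` and `τ̂⁻¹`. -/
def genOrbit (P : MonotonicityPartition τ) : Set unitInterval :=
  ⋂₀ {S | P.C ⊆ S ∧ hatImage τ S ⊆ S ∧ hatPreimage τ S ⊆ S}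

/-- The space `X`: the disconnection of `[0,1]` at the points of `I₁`. -/
abbrev Space (P : MonotonicityPartition τ) : Type := Disconnection P.genOrbit

/-- `X₀ = π⁻¹(I₀)`, where `I₀ = [0,1] \ I₁`. -/
def X₀ (P : MonotonicityPartition τ) : Set P.Space := Disconnection.collapse ⁻¹' P.genOrbitᶜ

theorem C_subset (P : MonotonicityPartition τ) : P.C ⊆ P.genOrbit := subset_sInter fun _ hS => hS.1

theorem mem_of_mem_hatMap (P : MonotonicityPartition τ) {x y : unitInterval} (hx : x ∈ P.genOrbit) (hy : y ∈ hatMap τ x) :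
    y ∈ P.genOrbit := by
  intro S hS
  exact hS.2.1 (mem_iUnion₂.2 ⟨x, hx S hS, hy⟩)

theorem mem_of_hatMap_mem (P : MonotonicityPartition τ) {x y : unitInterval} (hy : y ∈ hatMap τ x) (h : y ∈ P.genOrbit) :
    x ∈ P.genOrbit := by
  intro S hS
  exact hS.2.2 ⟨y, hy, h S hS⟩

theorem zero_mem_C (P : MonotonicityPartition τ) : (0 : unitInterval) ∈ P.C := ⟨0, P.first⟩

theorem one_mem_C (P : MonotonicityPartition τ) : (1 : unitInterval) ∈ P.C := ⟨Fin.last _, P.last⟩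

theorem exists_right (P : MonotonicityPartition τ) (t : unitInterval) (ht : t < 1) :
    ∃ i : Fin P.n, P.a i.castSucc ≤ t ∧ t < P.a i.succ := by
  by_contra! h
  have : ∀ j, P.a j ≤ t := by
    intro j
    induction j using Fin.induction with
    | zero => rw [P.first]; exact unitInterval.nonneg'
    | succ i ih => exact h i ih
  exact absurd (P.last ▸ this (Fin.last _)) (not_le.2 ht)

theorem exists_left (P : MonotonicityPartition τ) (t : unitInterval) (ht : 0 < t) :
    ∃ i : Fin P.n, P.a i.castSucc < t ∧ t ≤ P.a i.succ := by
  by_contra! h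
  have : ∀ j, P.a j < t := by
    intro j
    induction j using Fin.induction with
    | zero => rw [P.first]; exact ht
    | succ i ih => exact h i ih
  exact absurd (P.last ▸ this (Fin.last _)) (not_lt.2 unitInterval.le_one')

theorem exists_mem_Ioo (P : MonotonicityPartition τ) {t : unitInterval} (ht : t ∉ P.C) :
    ∃ i : Fin P.n, t ∈ Ioo (P.a i.castSucc) (P.a i.succ) := by
  have h1 : t ≠ 1 := fun h => ht (h ▸ P.one_mem_C)
  obtain ⟨i, hi, hi'⟩ := P.exists_right t (lt_of_le_of_ne unitInterval.le_one' h1)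
  exact ⟨i, lt_of_le_of_ne hi fun h => ht ⟨_, h⟩, hi'⟩

theorem continuousAt (P : MonotonicityPartition τ) {t : unitInterval} (ht : t ∉ P.C) : ContinuousAt τ t := by
  obtain ⟨i, hi⟩ := P.exists_mem_Ioo ht
  exact (P.continuousOn i).continuousAt (Ioo_mem_nhds hi.1 hi.2)

theorem neBot_left {t : unitInterval} (ht : 0 < t) : (𝓝[<] t).NeBot :=
  nhdsLT_neBot_of_exists_lt ⟨0, ht⟩

theorem neBot_right {t : unitInterval} (ht : t < 1) : (𝓝[>] t).NeBot :=
  nhdsGT_neBot_of_exists_gt ⟨1, ht⟩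

theorem hatMap_eq (P : MonotonicityPartition τ) {t : unitInterval} (ht : t ∉ P.C) : hatMap τ t = {τ t} := by
  have h0 : 0 < t := lt_of_le_of_ne unitInterval.nonneg' fun h => ht (h ▸ P.zero_mem_C)
  have hc := P.continuousAt ht
  have := neBot_left h0
  ext y
  constructor
  · rintro (⟨hn, h⟩ | ⟨hn, h⟩)
    · exact tendsto_nhds_unique h (hc.mono_left nhdsWithin_le_nhds)
    · exact tendsto_nhds_unique h (hc.mono_left nhdsWithin_le_nhds)
  · rintro rfl
    exact Or.inl ⟨inferInstance, hc.mono_left nhdsWithin_le_nhds⟩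

theorem map_notMem (P : MonotonicityPartition τ) {t : unitInterval} (ht : t ∉ P.genOrbit) : τ t ∉ P.genOrbit := fun h =>
  ht (P.mem_of_hatMap_mem (by rw [P.hatMap_eq fun h' => ht (P.C_subset h')]; rfl) h)

/-- One-sided limits exist and are approached strictly from one side. -/
theorem exists_tendsto_right (P : MonotonicityPartition τ) (t : unitInterval) (ht : t < 1) :
    ∃ v, Tendsto τ (𝓝[>] t) (𝓝[>] v) ∨ Tendsto τ (𝓝[>] t) (𝓝[<] v) := by
  obtain ⟨i, hi, hi'⟩ := P.exists_right t ht
  have hs : Ioo t (P.a i.succ) ⊆ Ioo (P.a i.castSucc) (P.a i.succ) := Ioo_subset_Ioo_left hi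
  have hne : (Ioo t (P.a i.succ)).Nonempty := nonempty_Ioo.2 hi'
  rcases P.monotonic i with h | h
  · refine ⟨_, Or.inl (tendsto_nhdsWithin_iff.2 ⟨
      (h.mono hs).monotoneOn.tendsto_nhdsWithin_Ioo_right hne (OrderBot.bddBelow _), ?_⟩)⟩
    filter_upwards [Ioo_mem_nhdsGT hi'] with z hz
    obtain ⟨w, hw⟩ := exists_between hz.1
    exact (csInf_le (OrderBot.bddBelow _) (mem_image_of_mem τ (show w ∈ Ioo t _ from ⟨hw.1, hw.2.trans hz.2⟩))).trans_lt
      (h (hs ⟨hw.1, hw.2.trans hz.2⟩) (hs hz) hw.2)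
  · refine ⟨_, Or.inr (tendsto_nhdsWithin_iff.2 ⟨
      (h.mono hs).antitoneOn.tendsto_nhdsWithin_Ioo_right hne (OrderTop.bddAbove _), ?_⟩)⟩
    filter_upwards [Ioo_mem_nhdsGT hi'] with z hz
    obtain ⟨w, hw⟩ := exists_between hz.1
    exact (h (hs ⟨hw.1, hw.2.trans hz.2⟩) (hs hz) hw.2).trans_le
      (le_csSup (OrderTop.bddAbove _) (mem_image_of_mem τ (show w ∈ Ioo t _ from ⟨hw.1, hw.2.trans hz.2⟩)))

theorem exists_tendsto_left (P : MonotonicityPartition τ) (t : unitInterval) (ht : 0 < t) :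
    ∃ v, Tendsto τ (𝓝[<] t) (𝓝[>] v) ∨ Tendsto τ (𝓝[<] t) (𝓝[<] v) := by
  obtain ⟨i, hi, hi'⟩ := P.exists_left t ht
  have hs : Ioo (P.a i.castSucc) t ⊆ Ioo (P.a i.castSucc) (P.a i.succ) := Ioo_subset_Ioo_right hi'
  have hne : (Ioo (P.a i.castSucc) t).Nonempty := nonempty_Ioo.2 hi
  rcases P.monotonic i with h | h
  · refine ⟨_, Or.inr (tendsto_nhdsWithin_iff.2 ⟨
      (h.mono hs).monotoneOn.tendsto_nhdsWithin_Ioo_left hne (OrderTop.bddAbove _), ?_⟩)⟩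
    filter_upwards [Ioo_mem_nhdsLT hi] with z hz
    obtain ⟨w, hw⟩ := exists_between hz.2
    exact (h (hs hz) (hs ⟨hz.1.trans hw.1, hw.2⟩) hw.1).trans_le
      (le_csSup (OrderTop.bddAbove _) (mem_image_of_mem τ (show w ∈ Ioo _ t from ⟨hz.1.trans hw.1, hw.2⟩)))
  · refine ⟨_, Or.inl (tendsto_nhdsWithin_iff.2 ⟨
      (h.mono hs).antitoneOn.tendsto_nhdsWithin_Ioo_left hne (OrderBot.bddBelow _), ?_⟩)⟩
    filter_upwards [Ioo_mem_nhdsLT hi] with z hz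
    obtain ⟨w, hw⟩ := exists_between hz.2
    exact (csInf_le (OrderBot.bddBelow _) (mem_image_of_mem τ (show w ∈ Ioo _ t from ⟨hz.1.trans hw.1, hw.2⟩))).trans_lt
      (h (hs hz) (hs ⟨hz.1.trans hw.1, hw.2⟩) hw.1)

theorem countable_hatMap (x : unitInterval) : (hatMap τ x).Countable := by
  have h1 : {y | (𝓝[<] x).NeBot ∧ Tendsto τ (𝓝[<] x) (𝓝 y)}.Subsingleton := by
    rintro y ⟨_, hy⟩ z ⟨_, hz⟩
    exact tendsto_nhds_unique hy hz
  have h2 : {y | (𝓝[>] x).NeBot ∧ Tendsto τ (𝓝[>] x) (𝓝 y)}.Subsingleton := by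
    rintro y ⟨_, hy⟩ z ⟨_, hz⟩
    exact tendsto_nhds_unique hy hz
  exact h1.countable.union h2.countable

theorem countable_hatPreimage (P : MonotonicityPartition τ) {A : Set unitInterval} (hA : A.Countable) :
    (hatPreimage τ A).Countable := by
  have h : hatPreimage τ A ⊆ P.C ∪ ⋃ y ∈ A, ⋃ i : Fin P.n,
      {x | x ∈ Ioo (P.a i.castSucc) (P.a i.succ) ∧ τ x = y} := by
    rintro x ⟨y, hy, hyA⟩
    by_cases hx : x ∈ P.C
    · exact Or.inl hx
    right
    obtain ⟨i, hi⟩ := P.exists_mem_Ioo hx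
    rw [P.hatMap_eq hx] at hy
    simp only [mem_iUnion]
    exact ⟨y, hyA, i, hi, hy.symm⟩
  refine Countable.mono h (Countable.union (countable_range _)
    (hA.biUnion fun y _ => countable_iUnion fun i => Subsingleton.countable ?_))
  rintro x ⟨hx, hxy⟩ z ⟨hz, hzy⟩
  have hinj : InjOn τ (Ioo (P.a i.castSucc) (P.a i.succ)) := by
    rcases P.monotonic i with h | h
    · exact h.injOn
    · exact h.injOn
  exact hinj hx hz (hxy.trans hzy.symm)

theorem countable_genOrbit (P : MonotonicityPartition τ) : P.genOrbit.Countable := by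
  let g : Set unitInterval → Set unitInterval := fun A => A ∪ hatImage τ A ∪ hatPreimage τ A
  have hc : ∀ k : ℕ, (g^[k] P.C).Countable := by
    intro k
    induction k with
    | zero => exact countable_range _
    | succ k ih =>
      rw [Function.iterate_succ_apply']
      exact (ih.union (ih.biUnion fun x _ => countable_hatMap x)).union
        (P.countable_hatPreimage ih)
  refine (countable_iUnion hc).mono (sInter_subset_of_mem ⟨?_, ?_, ?_⟩)
  · exact subset_iUnion_of_subset 0 subset_rfl
  · intro y hy
    obtain ⟨x, hx, hy⟩ := mem_iUnion₂.1 hy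
    obtain ⟨k, hk⟩ := mem_iUnion.1 hx
    refine mem_iUnion.2 ⟨k + 1, ?_⟩
    rw [Function.iterate_succ_apply']
    exact Or.inl (Or.inr (mem_iUnion₂.2 ⟨x, hk, hy⟩))
  · rintro x ⟨y, hy, hyA⟩
    obtain ⟨k, hk⟩ := mem_iUnion.1 hyA
    refine mem_iUnion.2 ⟨k + 1, ?_⟩
    rw [Function.iterate_succ_apply']
    exact Or.inr ⟨y, hy, hk⟩

theorem dense_X₀ (P : MonotonicityPartition τ) : Dense P.X₀ :=
  Disconnection.dense_preimage_compl P.countable_genOrbit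

open Disconnection in
theorem exists_tendsto (P : MonotonicityPartition τ) (x : P.Space) :
    ∃ y, Tendsto (fun z : P.Space => ptOver P.genOrbit (τ z.collapse) false) (𝓝[P.X₀] x) (𝓝 y) := by
  have hc : Tendsto (collapse : P.Space → unitInterval) (𝓝[P.X₀] x) (𝓝 x.collapse) :=
    continuous_collapse.continuousAt.mono_left nhdsWithin_le_nhds
  have right : x.collapse < 1 → Tendsto collapse (𝓝[P.X₀] x) (𝓝[>] x.collapse) →
      ∃ y, Tendsto (fun z : P.Space => ptOver P.genOrbit (τ z.collapse) false)
        (𝓝[P.X₀] x) (𝓝 y) := by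
    intro h1 h
    obtain ⟨v, hv | hv⟩ := P.exists_tendsto_right _ h1
    · exact ⟨_, tendsto_ptOver_true (by simp only [collapse_ptOver]; exact hv.comp h)⟩
    · exact ⟨_, tendsto_ptOver_false (by simp only [collapse_ptOver]; exact hv.comp h)⟩
  have left : 0 < x.collapse → Tendsto collapse (𝓝[P.X₀] x) (𝓝[<] x.collapse) →
      ∃ y, Tendsto (fun z : P.Space => ptOver P.genOrbit (τ z.collapse) false)
        (𝓝[P.X₀] x) (𝓝 y) := by
    intro h1 h
    obtain ⟨v, hv | hv⟩ := P.exists_tendsto_left _ h1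
    · exact ⟨_, tendsto_ptOver_true (by simp only [collapse_ptOver]; exact hv.comp h)⟩
    · exact ⟨_, tendsto_ptOver_false (by simp only [collapse_ptOver]; exact hv.comp h)⟩
  by_cases hx : x.collapse ∈ P.genOrbit
  · have hne : ∀ᶠ z in 𝓝[P.X₀] x, z.collapse ≠ x.collapse := by
      filter_upwards [self_mem_nhdsWithin] with z hz h
      exact hz (h ▸ hx)
    by_cases hx0 : x.collapse = 0
    · refine right (by simp [hx0]) (tendsto_nhdsWithin_iff.2 ⟨hc, ?_⟩)
      filter_upwards [hne] with z hz
      exact lt_of_le_of_ne (hx0 ▸ unitInterval.nonneg') hz.symm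
    have h0 : 0 < x.collapse := lt_of_le_of_ne unitInterval.nonneg' (Ne.symm hx0)
    by_cases hx1 : x.collapse = 1
    · refine left h0 (tendsto_nhdsWithin_iff.2 ⟨hc, ?_⟩)
      filter_upwards [hne] with z hz
      exact lt_of_le_of_ne (hx1 ▸ unitInterval.le_one') hz
    have h1 : x.collapse < 1 := lt_of_le_of_ne unitInterval.le_one' hx1
    have hlt : ptOver P.genOrbit x.collapse false < ptOver P.genOrbit x.collapse true := by
      have hm : x.collapse ∈ P.genOrbit \ {0, 1} := ⟨hx, by simp [hx0, hx1]⟩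
      change (ptOver P.genOrbit x.collapse false).1 < (ptOver P.genOrbit x.collapse true).1
      rw [ptOver_of_mem hm, ptOver_of_mem hm]
      exact Prod.Lex.lt_iff.2 (Or.inr ⟨rfl, Bool.false_lt_true⟩)
    rcases eq_ptOver x with h | h
    · refine left h0 (tendsto_nhdsWithin_iff.2 ⟨hc, ?_⟩)
      filter_upwards [hne, nhdsWithin_le_nhds (Iio_mem_nhds (h.trans_lt hlt))] with z hz hz'
      exact lt_of_le_of_ne (by simpa using collapse_mono (le_of_lt hz')) hz
    · refine right h1 (tendsto_nhdsWithin_iff.2 ⟨hc, ?_⟩)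
      filter_upwards [hne, nhdsWithin_le_nhds (Ioi_mem_nhds (hlt.trans_eq h.symm))] with z hz hz'
      exact lt_of_le_of_ne (by simpa using collapse_mono (le_of_lt hz')) hz.symm
  · refine ⟨_, tendsto_ptOver_of_notMem (fun h => P.map_notMem hx h.1) false ?_⟩
    simp only [collapse_ptOver]
    exact (P.continuousAt fun h => hx (P.C_subset h)).tendsto.comp hc

/-- There is a unique continuous map `σ : X → X` with `π ∘ σ = τ ∘ π` on `X₀`. -/
theorem existsUnique_localHomeo (P : MonotonicityPartition τ) :
    ∃! σ : P.Space → P.Space, Continuous σ ∧ ∀ x ∈ P.X₀, (σ x).collapse = τ x.collapse := by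
  have hcont := continuous_extendFrom P.dense_X₀ P.exists_tendsto
  refine ⟨_, ⟨hcont, fun x hx => ?_⟩, fun σ hσ => ?_⟩
  · have h := extendFrom_eq (P.dense_X₀ x) (Disconnection.tendsto_ptOver_of_notMem
      (f := fun z : P.Space => Disconnection.ptOver P.genOrbit (τ z.collapse) false)
      (fun h => P.map_notMem hx h.1) false (by
        simp only [Disconnection.collapse_ptOver]
        exact (P.continuousAt fun h => hx (P.C_subset h)).tendsto.comp
          (Disconnection.continuous_collapse.continuousAt.mono_left nhdsWithin_le_nhds)))
    rw [h, Disconnection.collapse_ptOver]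
  · refine Continuous.ext_on P.dense_X₀ hσ.1 hcont fun x hx => ?_
    have hm : τ x.collapse ∉ P.genOrbit := P.map_notMem hx
    have h := extendFrom_eq (P.dense_X₀ x) (Disconnection.tendsto_ptOver_of_notMem
      (f := fun z : P.Space => Disconnection.ptOver P.genOrbit (τ z.collapse) false)
      (fun h => hm h.1) false (by
        simp only [Disconnection.collapse_ptOver]
        exact (P.continuousAt fun h => hx (P.C_subset h)).tendsto.comp
          (Disconnection.continuous_collapse.continuousAt.mono_left nhdsWithin_le_nhds)))
    rw [h, Disconnection.eq_ptOver_of_notMem (σ x) (by rw [hσ.2 x hx]; exact fun h => hm h.1) false,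
      hσ.2 x hx]

/-- The local homeomorphism `σ : X → X` associated with `τ` (and its partition): the unique
continuous map such that `π ∘ σ = τ ∘ π` on `X₀`. -/
noncomputable def localHomeo (P : MonotonicityPartition τ) : P.Space → P.Space :=
  P.existsUnique_localHomeo.choose

/-- The image `τ(A)`, where `τ` is viewed as undefined on `C`. -/
def imageOff (P : MonotonicityPartition τ) (A : Set unitInterval) : Set unitInterval := τ '' (A \ P.C)

/-- `τ`, viewed as undefined on `C`, is transitive. -/
def Transitive (P : MonotonicityPartition τ) : Prop :=
  ∀ U V : Set unitInterval, IsOpen U → U.Nonempty → IsOpen V → V.Nonempty →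
    ∃ n : ℕ, (P.imageOff^[n] U ∩ V).Nonempty

end MonotonicityPartition

/-- `τ` is strongly transitive: for every non-empty open `U` there is `n` such that
`⋃ k ≤ n, τ̂ᵏ(U) = [0,1]`. -/
def HatStronglyTransitive (τ : unitInterval → unitInterval) : Prop :=
  ∀ U : Set unitInterval, IsOpen U → U.Nonempty →
    ∃ n : ℕ, (⋃ k ≤ n, (hatImage τ)^[k] U) = univ

/-! ## Transitivity of maps on topological spaces -/

/-- A (continuous) self-map `f` of a topological space is transitive. -/
def TopTransitive {X : Type*} [TopologicalSpace X] (f : X → X) : Prop :=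
  ∀ U V : Set X, IsOpen U → U.Nonempty → IsOpen V → V.Nonempty →
    ∃ n : ℕ, (f^[n] '' U ∩ V).Nonempty

/-- A (continuous) self-map `f` of a topological space is strongly transitive. -/
def TopStronglyTransitive {X : Type*} [TopologicalSpace X] (f : X → X) : Prop :=
  ∀ U : Set X, IsOpen U → U.Nonempty → ∃ n : ℕ, (⋃ k ≤ n, f^[k] '' U) = univ

/-! ### Recurrence and local monotonicity for transitive maps. -/

section Transitive

variable {X : Type*} [TopologicalSpace X] {σ : X → X}

/-! The implications close up in the cycle 1 → 3 → 4 → 2 → 1. All but 3 → 4 are transfers along the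
collapse map. The set I₁ is countable, so its complement is dense in I and X₀ is dense in X. Off I₁
the maps τ, τ̂ and σ agree and orbits never meet C, while everywhere π(σ(x)) ∈ τ̂(π(x)).

The substance is 3 → 4, proved in `TopTransitive.topStronglyTransitive` for a compact ordered space
without isolated points and an open continuous map, strictly monotone on finitely many clopen
intervals whose images are intervals. Let V be the union of all iterates of a convex open set. It is
open, forward invariant and, by transitivity, dense.

`TopTransitive.finite_components`: V has finitely many order components. A component without a
branch endpoint is mapped into a single component, so branching occurs only at the finitely many
components with an endpoint. A component that never leads to one of these must return to itself,
hence has finitely many successors. As the closure of a convex set adds at most two points, the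
complement of V is finite.

`TopTransitive.eq_empty_of_finite`: this complement F is backward invariant. Since σ is surjective,
it permutes F. If F were non-empty, an iterate of σ would fix some x ∈ F, be increasing near x and
have no other preimage of x. On a one-sided neighbourhood [x, y] it would then move y towards x or
away from it, giving a proper invariant set that contradicts transitivity. So V is everything, and
compactness leaves finitely many iterates.

That σ satisfies these hypotheses is shown by extending statements about τ from X₀ by density; the
branches and their images are clopen because their ends lie over I₁. -/

theorem TopTransitive.false_of_mapsTo (ht : TopTransitive σ) {M U V : Set X}
    (hM : MapsTo σ M M) (hU : IsOpen U) (hUne : U.Nonempty) (hUM : U ⊆ M)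
    (hV : IsOpen V) (hVne : V.Nonempty) (hVM : Disjoint M V) : False := by
  obtain ⟨n, _, ⟨x, hx, rfl⟩, hxV⟩ := ht U V hU hUne hV hVne
  exact hVM.notMem_of_mem_left (hM.iterate n (hUM hx)) hxV

theorem isOpenMap_iterate (hσ : IsOpenMap σ) (k : ℕ) : IsOpenMap σ^[k] := by
  induction k with
  | zero => exact IsOpenMap.id
  | succ k ih => exact ih.comp hσ

theorem exists_disjoint_isOpen_subset [T2Space X] (hX : ∀ x : X, (𝓝[≠] x).NeBot) {U : Set X}
    (hU : IsOpen U) (hne : U.Nonempty) : ∃ A B : Set X, IsOpen A ∧ A.Nonempty ∧ A ⊆ U ∧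
      IsOpen B ∧ B.Nonempty ∧ B ⊆ U ∧ Disjoint A B := by
  obtain ⟨x, hx⟩ := hne
  have := hX x
  obtain ⟨y, hyU, hyx⟩ := (frequently_iff.1
    (eventually_mem_nhdsWithin (a := x) (s := {x}ᶜ)).frequently)
    (mem_nhdsWithin_of_mem_nhds (hU.mem_nhds hx))
  obtain ⟨A, B, hA, hB, hyA, hxB, hAB⟩ := t2_separation hyx
  exact ⟨A ∩ U, B ∩ U, hA.inter hU, ⟨y, hyA, hyU⟩, inter_subset_right, hB.inter hU,
    ⟨x, hxB, hx⟩, inter_subset_right, hAB.mono inter_subset_left inter_subset_left⟩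

/-- Transitivity permits time 0, which says nothing about a set meeting itself. Going from one of
two disjoint open pieces of U to the other forces a positive time. -/
theorem TopTransitive.exists_pos [T2Space X] (ht : TopTransitive σ)
    (hX : ∀ x : X, (𝓝[≠] x).NeBot) {U : Set X} (hU : IsOpen U) (hne : U.Nonempty) :
    ∃ n, 0 < n ∧ (σ^[n] '' U ∩ U).Nonempty := by
  obtain ⟨A, B, hA, hAne, hAU, hB, hBne, hBU, hAB⟩ := exists_disjoint_isOpen_subset hX hU hne
  obtain ⟨n, y, hy, hyB⟩ := ht A B hA hAne hB hBne
  refine ⟨n, Nat.pos_of_ne_zero ?_, y, image_mono hAU hy, hBU hyB⟩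
  rintro rfl
  exact hAB.notMem_of_mem_left (by simpa using hy) hyB

/-- The range is compact, so its complement is open; but no point outside the range is reached at a
positive time, so that complement cannot return to itself. -/
theorem TopTransitive.surjective [T2Space X] [CompactSpace X] (ht : TopTransitive σ)
    (hσ : Continuous σ) (hX : ∀ x : X, (𝓝[≠] x).NeBot) : Function.Surjective σ := by
  rw [← range_eq_univ]
  by_contra h
  obtain ⟨n, hn, y, ⟨x, -, rfl⟩, hy⟩ := ht.exists_pos hX
    (isCompact_range hσ).isClosed.isOpen_compl (nonempty_compl.2 h)
  obtain ⟨m, rfl⟩ := Nat.exists_eq_succ_of_ne_zero hn.ne'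
  exact hy ⟨σ^[m] x, (Function.iterate_succ_apply' σ m x).symm⟩

theorem exists_nhds_strictMonoOn_iterate [LinearOrder X] (hσ : Continuous σ)
    (hloc : ∀ x, ∃ N ∈ 𝓝 x, StrictMonoOn σ N ∨ StrictAntiOn σ N) (k : ℕ) (x : X) :
    ∃ N ∈ 𝓝 x, StrictMonoOn σ^[k] N ∨ StrictAntiOn σ^[k] N := by
  induction k with
  | zero => exact ⟨univ, univ_mem, Or.inl (strictMono_id.strictMonoOn _)⟩
  | succ k ih =>
    obtain ⟨N, hN, hN'⟩ := ih
    obtain ⟨A, hA, hA'⟩ := hloc (σ^[k] x)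
    have hm : MapsTo σ^[k] (N ∩ σ^[k] ⁻¹' A) A := fun w hw => hw.2
    refine ⟨N ∩ σ^[k] ⁻¹' A,
      inter_mem hN ((hσ.iterate k).continuousAt.preimage_mem_nhds hA), ?_⟩
    rw [Function.iterate_succ']
    rcases hN' with h1 | h1 <;> rcases hA' with h2 | h2
    · exact Or.inl (h2.comp (h1.mono inter_subset_left) hm)
    · exact Or.inr (h2.comp_strictMonoOn (h1.mono inter_subset_left) hm)
    · exact Or.inr (h2.comp_strictAntiOn (h1.mono inter_subset_left) hm)
    · exact Or.inl (h2.comp (h1.mono inter_subset_left) hm)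

end Transitive

/-! ### Transitive piecewise monotone maps of compact ordered spaces. -/

section LinearOrder

variable {X : Type*} [LinearOrder X] [TopologicalSpace X] [OrderTopology X] {σ : X → X}

theorem eventually_Icc_subset {x : X} {W : Set X} (hW : W ∈ 𝓝 x) :
    ∀ᶠ y in 𝓝[>] x, Icc x y ⊆ W :=
  (((tendsto_const_nhds (x := x)).Icc tendsto_id).eventually
    (eventually_smallSets_subset.2 hW)).filter_mono nhdsWithin_le_nhds

/-- A transitive map has no periodic point `x`, not isolated from the right, such that an iterate
fixing `x` is increasing near `x` and has no other preimage of `x`, if some point `z` lies neither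
on the forward nor on a backward orbit of `x`. -/
theorem TopTransitive.false_of_fixed_right [CompactSpace X] (ht : TopTransitive σ)
    (hσ : Continuous σ) {x z : X} {q : ℕ} (hq : 0 < q) (hx : σ^[q] x = x)
    (hfib : ∀ y, σ^[q] y = x → y = x) {N : Set X} (hN : N ∈ 𝓝 x)
    (hmono : StrictMonoOn σ^[q] N) (hne : (𝓝[>] x).NeBot)
    (hzx : ∀ j, σ^[j] z ≠ x) (hxz : ∀ j, σ^[j] x ≠ z) : False := by
  -- Everything that `σ^[q]` sends into this neighbourhood of x lies in N: the image of the
  -- complement of the interior of N is closed and misses x, whose only preimage is x.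
  have hW : (σ^[q] '' (interior N)ᶜ)ᶜ ∈ 𝓝 x := by
    refine IsOpen.mem_nhds ?_ ?_
    · exact ((isOpen_interior.isClosed_compl.isCompact).image
        (hσ.iterate q)).isClosed.isOpen_compl
    · rintro ⟨y, hy, hyx⟩
      exact hy (hfib y hyx ▸ mem_interior_iff_mem_nhds.2 hN)
  have hz1 : ∀ j : Fin q, (σ^[j])⁻¹' {z}ᶜ ∈ 𝓝 x := fun j =>
    (hσ.iterate j).continuousAt.preimage_mem_nhds (isOpen_compl_singleton.mem_nhds (hxz j))
  have hz2 : ∀ j : Fin q, {σ^[j] z}ᶜ ∈ 𝓝 x := fun j =>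
    isOpen_compl_singleton.mem_nhds (hzx j).symm
  obtain ⟨y, hxy, hyN, hyW, hy1, hy2⟩ := ((eventually_mem_nhdsWithin (a := x) (s := Ioi x)).and
    ((eventually_Icc_subset hN).and ((eventually_Icc_subset hW).and
      ((eventually_Icc_subset (iInter_mem.2 hz1)).and
        (eventually_Icc_subset (iInter_mem.2 hz2)))))).exists
  have hxy : x < y := hxy
  have hIoo : (Ioo x y).Nonempty := by
    have h : Ioo x y ∈ 𝓝[>] x := Ioo_mem_nhdsGT hxy
    exact Filter.nonempty_of_mem h
  have hxN : x ∈ N := hyN ⟨le_rfl, hxy.le⟩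
  have hyN' : y ∈ N := hyN ⟨hxy.le, le_rfl⟩
  -- If y does not move away from x, the first q images of [x, y] form a forward invariant closed
  -- set missing z. Otherwise the first q preimages form a backward invariant closed set missing z,
  -- and its complement is forward invariant.
  rcases le_total (σ^[q] y) y with hgy | hgy
  · let M : Set X := ⋃ j : Fin q, σ^[j] '' Icc x y
    have hMc : IsClosed M := isClosed_iUnion_of_finite fun j =>
      ((isClosed_Icc.isCompact).image (hσ.iterate j)).isClosed
    refine ht.false_of_mapsTo (M := M) ?_ isOpen_Ioo hIoo ?_ hMc.isOpen_compl ⟨z, ?_⟩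
      disjoint_compl_right
    · intro w hw
      obtain ⟨j, v, hv, rfl⟩ := mem_iUnion.1 hw
      rw [← Function.iterate_succ_apply' σ]
      by_cases hj : (j : ℕ) + 1 < q
      · exact mem_iUnion.2 ⟨⟨j + 1, hj⟩, v, hv, rfl⟩
      · have hj' : (j : ℕ).succ = q := by omega
        refine mem_iUnion.2 ⟨⟨0, hq⟩, σ^[q] v, ⟨?_, ?_⟩, ?_⟩
        · calc x = σ^[q] x := hx.symm
            _ ≤ _ := hmono.monotoneOn hxN (hyN hv) hv.1
        · exact (hmono.monotoneOn (hyN hv) hyN' hv.2).trans hgy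
        · rw [hj']; rfl
    · exact fun w hw => mem_iUnion.2 ⟨⟨0, hq⟩, w, Ioo_subset_Icc_self hw, rfl⟩
    · intro hz
      obtain ⟨j, v, hv, hvz⟩ := mem_iUnion.1 hz
      exact mem_iInter.1 (hy1 hv) j hvz
  · let M : Set X := ⋃ j : Fin q, (σ^[j])⁻¹' Icc x y
    have hMc : IsClosed M := isClosed_iUnion_of_finite fun j =>
      isClosed_Icc.preimage (hσ.iterate j)
    refine ht.false_of_mapsTo (M := Mᶜ) ?_ hMc.isOpen_compl ⟨z, ?_⟩ subset_rfl isOpen_Ioo hIoo ?_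
    · intro w hw hσw
      apply hw
      obtain ⟨j, hj⟩ := mem_iUnion.1 hσw
      rw [mem_preimage, ← Function.iterate_succ_apply] at hj
      by_cases hjq : (j : ℕ) + 1 < q
      · exact mem_iUnion.2 ⟨⟨j + 1, hjq⟩, hj⟩
      · have hj' : (j : ℕ).succ = q := by omega
        rw [hj'] at hj
        have hwN : w ∈ N := by
          by_contra hwN
          exact hyW hj ⟨w, fun h => hwN (interior_subset h), rfl⟩
        refine mem_iUnion.2 ⟨⟨0, hq⟩, ?_, ?_⟩
        · exact (hmono.le_iff_le hxN hwN).1 (hx.le.trans hj.1)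
        · exact (hmono.le_iff_le hwN hyN').1 (hj.2.trans hgy)
    · intro hz
      obtain ⟨j, hj⟩ := mem_iUnion.1 hz
      exact mem_iInter.1 (hy2 hj) j rfl
    · rw [disjoint_compl_left_iff_subset]
      exact fun w hw => mem_iUnion.2 ⟨⟨0, hq⟩, Ioo_subset_Icc_self hw⟩

/-- Reversing the order swaps the two sides of x and keeps increasing maps increasing, so the
right-sided case suffices. -/
theorem TopTransitive.false_of_fixed [CompactSpace X] (ht : TopTransitive σ)
    (hσ : Continuous σ) {x z : X} {q : ℕ} (hq : 0 < q) (hx : σ^[q] x = x)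
    (hfib : ∀ y, σ^[q] y = x → y = x) {N : Set X} (hN : N ∈ 𝓝 x)
    (hmono : StrictMonoOn σ^[q] N) (hne : (𝓝[≠] x).NeBot)
    (hzx : ∀ j, σ^[j] z ≠ x) (hxz : ∀ j, σ^[j] x ≠ z) : False := by
  rw [← nhdsLT_sup_nhdsGT, sup_neBot] at hne
  have : CompactSpace Xᵒᵈ := ‹CompactSpace X›
  rcases hne with hne | hne
  · exact TopTransitive.false_of_fixed_right (X := Xᵒᵈ) (σ := σ) ht hσ hq hx hfib hN hmono.dual hne
      hzx hxz
  · exact ht.false_of_fixed_right hσ hq hx hfib hN hmono hne hzx hxz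

/-- A proper finite backward invariant set of a transitive locally monotonic map is empty. -/
theorem TopTransitive.eq_empty_of_finite [CompactSpace X] (ht : TopTransitive σ)
    (hσ : Continuous σ) (hX : ∀ x : X, (𝓝[≠] x).NeBot)
    (hloc : ∀ x, ∃ N ∈ 𝓝 x, StrictMonoOn σ N ∨ StrictAntiOn σ N) {F : Set X} (hF : F.Finite)
    (hinv : σ ⁻¹' F ⊆ F) : F = ∅ := by
  by_contra hFne
  obtain ⟨x, hxF⟩ := nonempty_iff_ne_empty.2 hFne
  have hsurj := ht.surjective hσ hX
  have hFt : Finite F := hF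
  -- Backward invariance makes a right inverse of σ act on F. It is injective, hence bijective as F
  -- is finite, so σ permutes F.
  let s : F → F := fun y => ⟨Function.surjInv hsurj y, hinv (by
    rw [mem_preimage, Function.surjInv_eq hsurj]; exact y.2)⟩
  have hs : ∀ y, σ (s y) = y := fun y => Function.surjInv_eq hsurj y
  have hsinj : Function.Injective s := fun y y' h => Subtype.ext (by rw [← hs y, h, hs])
  have hssurj : Function.Surjective s := Finite.surjective_of_injective hsinj
  have hmaps : MapsTo σ F F := fun y hy => by
    obtain ⟨y', hy'⟩ := hssurj ⟨y, hy⟩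
    have := hs y'
    rw [hy'] at this
    exact this ▸ y'.2
  have hinj : InjOn σ F := fun y hy y' hy' h => by
    obtain ⟨u, hu⟩ := hssurj ⟨y, hy⟩
    obtain ⟨u', hu'⟩ := hssurj ⟨y', hy'⟩
    have h1 := hs u
    have h2 := hs u'
    rw [hu] at h1
    rw [hu'] at h2
    have : u = u' := Subtype.ext (h1.symm.trans (h.trans h2))
    subst this
    exact congrArg Subtype.val (hu.symm.trans hu')
  have hinv' : ∀ k y, σ^[k] y ∈ F → y ∈ F := by
    intro k
    induction k with
    | zero => exact fun y hy => hy
    | succ k ih => exact fun y hy => hinv (ih (σ y) hy)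
  have hinjk : ∀ k, InjOn σ^[k] F := fun k => hinj.iterate hmaps k
  obtain ⟨p, hp, hpx⟩ : ∃ p, 0 < p ∧ σ^[p] x = x := by
    obtain ⟨m, n, hmn, h⟩ := Finite.exists_ne_map_eq_of_infinite
      (fun k : ℕ => (⟨σ^[k] x, hmaps.iterate k hxF⟩ : F))
    have h : σ^[m] x = σ^[n] x := congrArg Subtype.val h
    wlog hlt : m < n generalizing m n
    · exact this n m hmn.symm (Subtype.ext h.symm) h.symm (lt_of_le_of_ne (not_lt.1 hlt) hmn.symm)
    refine ⟨n - m, Nat.sub_pos_of_lt hlt, ?_⟩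
    apply hinjk m (hmaps.iterate _ hxF) hxF
    rw [← Function.iterate_add_apply, Nat.add_sub_cancel' hlt.le, h]
  obtain ⟨q, hq, hqx, N, hN, hmono⟩ : ∃ q, 0 < q ∧ σ^[q] x = x ∧ ∃ N ∈ 𝓝 x,
      StrictMonoOn σ^[q] N := by
    obtain ⟨N, hN, hN' | hN'⟩ := exists_nhds_strictMonoOn_iterate hσ hloc p x
    · exact ⟨p, hp, hpx, N, hN, hN'⟩
    -- An order-reversing return map becomes order-preserving when squared.
    · refine ⟨p + p, by omega, by rw [Function.iterate_add_apply, hpx, hpx],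
        N ∩ σ^[p] ⁻¹' N, inter_mem hN ((hσ.iterate p).continuousAt.preimage_mem_nhds
          (by rwa [hpx])), ?_⟩
      rw [Function.iterate_add]
      exact hN'.comp (hN'.mono inter_subset_left) fun w hw => hw.2
  have hFc : Fᶜ ∈ 𝓝[≠] x := by
    rw [mem_nhdsWithin_iff_exists_mem_nhds_inter]
    exact ⟨(F \ {x})ᶜ, (hF.subset sdiff_subset).isClosed.isOpen_compl.mem_nhds (by simp),
      fun w hw hwF => hw.1 ⟨hwF, hw.2⟩⟩
  have := hX x
  -- Since F is invariant in both directions, any point off F is unrelated to x by orbits.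
  obtain ⟨z, hz⟩ := Filter.nonempty_of_mem hFc
  exact ht.false_of_fixed hσ hq hqx
    (fun y hy => hinjk q (hinv' q y (hy ▸ hxF)) hxF (hy.trans hqx.symm)) hN hmono (hX x)
    (fun j hj => hz (hinv' j z (hj ▸ hxF))) (fun j hj => hz (hj ▸ hmaps.iterate j hxF))

theorem isOpen_ordConnectedComponent {V : Set X} (hV : IsOpen V) (x : X) :
    IsOpen (ordConnectedComponent V x) := by
  rw [isOpen_iff_mem_nhds]
  intro y hy
  rw [ordConnectedComponent_eq hy]
  exact ordConnectedComponent_mem_nhds.2 (hV.mem_nhds (hy right_mem_uIcc))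

/-- By convexity a closure point outside J lies below or above all of J, hence is its infimum or its
supremum. -/
theorem Set.OrdConnected.finite_closure_diff {J : Set X} (hJ : J.OrdConnected) :
    (closure J \ J).Finite := by
  have h : closure J \ J ⊆ {p | IsGLB J p} ∪ {p | IsLUB J p} := by
    rintro p ⟨hp, hpJ⟩
    by_cases hl : p ∈ lowerBounds J
    · exact Or.inl (isGLB_of_mem_closure hl hp)
    · refine Or.inr (isLUB_of_mem_closure (fun b hb => ?_) hp)
      simp only [lowerBounds, mem_ofPred_eq, not_forall, not_le] at hl
      obtain ⟨a, ha, hap⟩ := hl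
      by_contra hbp
      exact hpJ (hJ.out ha hb ⟨hap.le, (not_le.1 hbp).le⟩)
  refine Finite.subset (Finite.union (Subsingleton.finite ?_) (Subsingleton.finite ?_)) h
  · exact fun p hp p' hp' => hp.unique hp'
  · exact fun p hp p' hp' => hp.unique hp'

/-- The complement of a dense set with finitely many order components is finite. -/
theorem finite_compl_of_finite_components {V : Set X} (hd : Dense V)
    (hfin : (ordConnectedComponent V '' V).Finite) : Vᶜ.Finite := by
  have hV : V = ⋃ J ∈ ordConnectedComponent V '' V, J := by
    apply subset_antisymm
    · exact fun v hv => mem_biUnion (mem_image_of_mem _ hv) (self_mem_ordConnectedComponent.2 hv)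
    · refine iUnion₂_subset ?_
      rintro _ ⟨v, -, rfl⟩
      exact ordConnectedComponent_subset
  refine Finite.subset (hfin.biUnion (t := fun J => closure J \ J) ?_) fun x hx => ?_
  · rintro _ ⟨v, -, rfl⟩
    exact Set.OrdConnected.finite_closure_diff inferInstance
  · have h := hd x
    rw [hV, hfin.closure_biUnion] at h
    obtain ⟨J, hJ, hxJ⟩ := mem_iUnion₂.1 h
    refine mem_iUnion₂.2 ⟨J, hJ, hxJ, fun hxJ' => hx ?_⟩
    rw [hV]
    exact mem_biUnion hJ hxJ'

/-- The forward orbit of an open convex set under a transitive piecewise monotonic map has only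
finitely many components. -/
theorem TopTransitive.finite_components {ι : Type*} [Finite ι] {l r : ι → X}
    (ht : TopTransitive σ) (hopen : IsOpenMap σ) (hX : ∀ x : X, (𝓝[≠] x).NeBot)
    (hcov : ∀ x, ∃ i, x ∈ Icc (l i) (r i))
    (hconn : ∀ i, ∀ J ⊆ Icc (l i) (r i), J.OrdConnected → (σ '' J).OrdConnected)
    {U : Set X} (hU : IsOpen U) (hUc : U.OrdConnected) (hUne : U.Nonempty) :
    (ordConnectedComponent (⋃ k, σ^[k] '' U) '' (⋃ k, σ^[k] '' U)).Finite := by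
  set V : Set X := ⋃ k, σ^[k] '' U with hVdef
  have hVo : IsOpen V := isOpen_iUnion fun k => isOpenMap_iterate hopen k U hU
  have hVσ : MapsTo σ V V := fun v hv => by
    obtain ⟨k, u, hu, rfl⟩ := mem_iUnion.1 hv
    exact mem_iUnion.2 ⟨k + 1, u, hu, Function.iterate_succ_apply' σ k u⟩
  have hUV : U ⊆ V := fun u hu => mem_iUnion.2 ⟨0, u, hu, rfl⟩
  have trans : ∀ {a b c : X}, uIcc a b ⊆ V → uIcc b c ⊆ V → uIcc a c ⊆ V := fun h1 h2 =>
    uIcc_subset_uIcc_union_uIcc.trans (union_subset h1 h2)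
  have symm : ∀ {a b : X}, uIcc a b ⊆ V → uIcc b a ⊆ V := fun h => by rwa [uIcc_comm]
  have step : ∀ {i w w'}, w ∈ Icc (l i) (r i) → w' ∈ Icc (l i) (r i) → uIcc w w' ⊆ V →
      uIcc (σ w) (σ w') ⊆ V := by
    intro i w w' hw hw' h
    have := hconn i (uIcc w w') (ordConnected_Icc.uIcc_subset hw hw') ordConnected_uIcc
    refine (this.uIcc_subset (mem_image_of_mem σ left_mem_uIcc)
      (mem_image_of_mem σ right_mem_uIcc)).trans ?_
    rintro _ ⟨v, hv, rfl⟩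
    exact hVσ (h hv)
  let cut : ι ⊕ ι → X := Sum.elim l r
  -- Two points of V share a component exactly when the interval between them lies in V. So for w in
  -- V, this says that its component contains no branch endpoint.
  let single : X → Prop := fun w => ∀ c, ¬ uIcc w (cut c) ⊆ V
  have step_single : ∀ {w w'}, single w → uIcc w w' ⊆ V → uIcc (σ w) (σ w') ⊆ V := by
    intro w w' hw h
    obtain ⟨i, hi⟩ := hcov w
    refine step hi ?_ h
    -- If w' left the branch of w, an end of that branch would lie between them, hence in the
    -- component of w.
    by_contra hw'
    rw [mem_Icc, not_and_or, not_le, not_le] at hw'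
    rcases hw' with h' | h'
    · refine hw (Sum.inl i) ((uIcc_subset_uIcc_left ?_).trans h)
      exact mem_uIcc.2 (Or.inr ⟨h'.le, hi.1⟩)
    · refine hw (Sum.inr i) ((uIcc_subset_uIcc_left ?_).trans h)
      exact mem_uIcc.2 (Or.inl ⟨hi.2, h'.le⟩)
  obtain ⟨u₀, hu₀⟩ := hUne
  -- The component of a cut point may be split by σ, but its part in one branch goes into one
  -- component. One representative per pair (cut, branch) records this; `u₀` is a filler for empty
  -- pairs.
  have hrep : ∀ p : (ι ⊕ ι) × ι, ∃ s ∈ V, ∀ w, w ∈ Icc (l p.2) (r p.2) → uIcc w (cut p.1) ⊆ V →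
      uIcc s (σ w) ⊆ V := by
    intro p
    by_cases h : ∃ w, w ∈ Icc (l p.2) (r p.2) ∧ uIcc w (cut p.1) ⊆ V
    · obtain ⟨w, hw, hwc⟩ := h
      exact ⟨σ w, hVσ (hwc left_mem_uIcc), fun w' hw' hwc' => step hw hw' (trans hwc (symm hwc'))⟩
    · exact ⟨u₀, hUV hu₀, fun w hw hwc => (h ⟨w, hw, hwc⟩).elim⟩
  choose s hsV hs using hrep
  let S : Set X := insert u₀ (range s)
  have hS : S.Finite := (finite_range s).insert u₀
  have hSV : S ⊆ V := insert_subset (hUV hu₀) (range_subset_iff.2 hsV)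
  -- The orbit is followed componentwise and restarted at a representative in S after each visit to
  -- a component with a cut point.
  have key : ∀ m, ∀ u ∈ U, ∃ t ∈ S, ∃ k, (∀ j < k, single (σ^[j] t)) ∧
      uIcc (σ^[k] t) (σ^[m] u) ⊆ V := by
    intro m u hu
    induction m with
    | zero => exact ⟨u₀, mem_insert _ _, 0, by simp, (hUc.uIcc_subset hu₀ hu).trans hUV⟩
    | succ m ih =>
      obtain ⟨t, htS, k, hk, hkm⟩ := ih
      rw [Function.iterate_succ_apply']
      by_cases hsing : single (σ^[k] t)
      · refine ⟨t, htS, k + 1, fun j hj => ?_, ?_⟩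
        · rcases Nat.lt_succ_iff_lt_or_eq.1 hj with h | rfl
          · exact hk j h
          · exact hsing
        · rw [Function.iterate_succ_apply']
          exact step_single hsing hkm
      · simp only [single, not_forall, not_not] at hsing
        obtain ⟨c, hc⟩ := hsing
        obtain ⟨i, hi⟩ := hcov (σ^[m] u)
        exact ⟨s (c, i), mem_insert_of_mem _ (mem_range_self _), 0, by simp,
          hs (c, i) _ hi (trans (symm hkm) hc)⟩
  have hfin : ∀ t ∈ S, {J | ∃ k, (∀ j < k, single (σ^[j] t)) ∧
      J = ordConnectedComponent V (σ^[k] t)}.Finite := by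
    intro t htS
    -- If no cut point is ever met, the component of t, which returns to itself by transitivity,
    -- cycles through finitely many components. Otherwise the first meeting bounds k.
    by_cases hall : ∀ j, single (σ^[j] t)
    · have hcomp : ∀ {n w w'}, (∀ j < n, single (σ^[j] w)) → uIcc w w' ⊆ V →
          uIcc (σ^[n] w) (σ^[n] w') ⊆ V := by
        intro n w w' hw hww'
        induction n with
        | zero => exact hww'
        | succ n ih =>
          rw [Function.iterate_succ_apply', Function.iterate_succ_apply']
          exact step_single (hw n n.lt_succ_self) (ih fun j hj => hw j (hj.trans n.lt_succ_self))
      obtain ⟨n, hn, _, ⟨w, hw, rfl⟩, hw'⟩ := ht.exists_pos hX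
        (isOpen_ordConnectedComponent hVo t)
        ⟨t, self_mem_ordConnectedComponent.2 (hSV htS)⟩
      have hret : uIcc t (σ^[n] t) ⊆ V := trans hw' (symm (hcomp (fun j _ => hall j) hw))
      have hper : ∀ k, ∃ j < n, uIcc (σ^[j] t) (σ^[k] t) ⊆ V := by
        intro k
        induction k with
        | zero => exact ⟨0, hn, by simpa using hSV htS⟩
        | succ k ih =>
          obtain ⟨j, hj, hjk⟩ := ih
          have h := step_single (hall j) hjk
          rw [← Function.iterate_succ_apply' σ, ← Function.iterate_succ_apply' σ] at h
          by_cases hjn : j + 1 < n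
          · exact ⟨j + 1, hjn, h⟩
          · have : j.succ = n := by omega
            rw [this] at h
            exact ⟨0, hn, trans hret h⟩
      refine ((finite_lt_nat n).image fun j => ordConnectedComponent V (σ^[j] t)).subset ?_
      rintro _ ⟨k, -, rfl⟩
      obtain ⟨j, hj, hjk⟩ := hper k
      exact ⟨j, hj, ordConnectedComponent_eq hjk⟩
    · push Not at hall
      obtain ⟨j, hj⟩ := hall
      refine ((finite_le_nat j).image fun k => ordConnectedComponent V (σ^[k] t)).subset ?_
      rintro _ ⟨k, hk, rfl⟩
      exact ⟨k, not_lt.1 fun h => hj (hk j h), rfl⟩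
  refine (hS.biUnion hfin).subset ?_
  rintro _ ⟨v, hv, rfl⟩
  obtain ⟨m, u, hu, rfl⟩ := mem_iUnion.1 hv
  obtain ⟨t, htS, k, hk, hkm⟩ := key m u hu
  exact mem_iUnion₂.2 ⟨t, htS, k, hk, (ordConnectedComponent_eq hkm).symm⟩

/-- A transitive piecewise monotonic open map of a compact linearly ordered space without isolated
points is strongly transitive. -/
theorem TopTransitive.topStronglyTransitive [CompactSpace X] {ι : Type*} [Finite ι] {l r : ι → X}
    (ht : TopTransitive σ) (hσ : Continuous σ) (hopen : IsOpenMap σ)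
    (hX : ∀ x : X, (𝓝[≠] x).NeBot) (hcov : ∀ x, ∃ i, x ∈ Icc (l i) (r i))
    (hE : ∀ i, IsOpen (Icc (l i) (r i)))
    (hmono : ∀ i, StrictMonoOn σ (Icc (l i) (r i)) ∨ StrictAntiOn σ (Icc (l i) (r i)))
    (hconn : ∀ i, (σ '' Icc (l i) (r i)).OrdConnected) : TopStronglyTransitive σ := by
  intro U hU hUne
  obtain ⟨x, hx⟩ := hUne
  -- Counting components requires the orbit to start from a convex set.
  let U' := ordConnectedComponent U x
  have hU' : IsOpen U' := isOpen_ordConnectedComponent hU x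
  have hU'ne : U'.Nonempty := ⟨x, self_mem_ordConnectedComponent.2 hx⟩
  have hconn' : ∀ i, ∀ J ⊆ Icc (l i) (r i), J.OrdConnected → (σ '' J).OrdConnected := by
    intro i J hJ hJc
    constructor
    rintro _ ⟨a, ha, rfl⟩ _ ⟨b, hb, rfl⟩ y hy
    obtain ⟨c, hc, rfl⟩ := (hconn i).out (mem_image_of_mem σ (hJ ha))
      (mem_image_of_mem σ (hJ hb)) hy
    refine ⟨c, ?_, rfl⟩
    rcases hmono i with h | h
    · exact hJc.out ha hb ⟨(h.le_iff_le (hJ ha) hc).1 hy.1, (h.le_iff_le hc (hJ hb)).1 hy.2⟩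
    · exact hJc.out hb ha ⟨(h.le_iff_ge hc (hJ hb)).1 hy.2, (h.le_iff_ge (hJ ha) hc).1 hy.1⟩
  let V : Set X := ⋃ k, σ^[k] '' U'
  have hVσ : MapsTo σ V V := fun v hv => by
    obtain ⟨k, u, hu, rfl⟩ := mem_iUnion.1 hv
    exact mem_iUnion.2 ⟨k + 1, u, hu, Function.iterate_succ_apply' σ k u⟩
  have hd : Dense V := by
    rw [dense_iff_inter_open]
    intro W hW hWne
    obtain ⟨n, y, hy, hyW⟩ := ht U' W hU' hU'ne hW hWne
    exact ⟨y, hyW, mem_iUnion.2 ⟨n, hy⟩⟩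
  have hfin := finite_compl_of_finite_components hd
    (ht.finite_components hopen hX hcov hconn' hU' inferInstance hU'ne)
  have hV : V = univ := by
    rw [← compl_empty_iff]
    refine ht.eq_empty_of_finite hσ hX (fun x => ?_) hfin fun y hy hyV => hy (hVσ hyV)
    obtain ⟨i, hi⟩ := hcov x
    exact ⟨_, (hE i).mem_nhds hi, hmono i⟩
  obtain ⟨t, ht'⟩ := isCompact_univ.elim_finite_subcover (fun k => σ^[k] '' U)
    (fun k => isOpenMap_iterate hopen k U hU) (by
      rw [← hV]
      exact iUnion_mono fun k => image_mono ordConnectedComponent_subset)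
  refine ⟨t.sup id, eq_univ_of_univ_subset (ht'.trans (iUnion₂_subset fun k hk => ?_))⟩
  exact subset_biUnion_of_mem (u := fun k => σ^[k] '' U)
    (show k ∈ {k | k ≤ t.sup id} from Finset.le_sup (f := id) hk)

end LinearOrder

/-- By injectivity, σ(E i ∩ U) is σ(E i) minus σ(E i \ U), an open set minus a compact one. -/
theorem IsOpenMap.of_finite_cover {X : Type*} [TopologicalSpace X] [CompactSpace X] [T2Space X]
    {ι : Type*} {σ : X → X} {E : ι → Set X} (hσ : Continuous σ) (hcov : ∀ x, ∃ i, x ∈ E i)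
    (hE : ∀ i, IsClosed (E i)) (hinj : ∀ i, InjOn σ (E i)) (him : ∀ i, IsOpen (σ '' E i)) :
    IsOpenMap σ := by
  intro U hU
  have h : σ '' U = ⋃ i, (σ '' E i) \ σ '' (E i \ U) := by
    ext y
    simp only [mem_iUnion]
    constructor
    · rintro ⟨x, hx, rfl⟩
      obtain ⟨i, hi⟩ := hcov x
      refine ⟨i, mem_image_of_mem σ hi, ?_⟩
      rintro ⟨x', hx', h⟩
      exact hx'.2 (hinj i hx'.1 hi h ▸ hx)
    · rintro ⟨i, ⟨x, hx, rfl⟩, hn⟩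
      exact mem_image_of_mem σ (by_contra fun hxU => hn ⟨x, ⟨hx, hxU⟩, rfl⟩)
  rw [h]
  exact isOpen_iUnion fun i => (him i).sdiff
    ((((hE i).sdiff hU).isCompact).image hσ).isClosed

/-! ### Topology of the disconnected interval. -/

namespace Disconnection

variable {S : Set unitInterval}

/-- The image of an ultrafilter converges to some t in [0,1]. The ultrafilter itself lives strictly
below t, strictly above t, or on the at most two points over t; each alternative determines a limit.
-/
instance : CompactSpace (Disconnection S) := by
  refine ⟨isCompact_iff_ultrafilter_le_nhds.2 fun f _ => ?_⟩
  obtain ⟨t, -, ht⟩ := isCompact_iff_ultrafilter_le_nhds.1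
    (isCompact_univ (X := unitInterval)) (f.map collapse) (by simp)
  have ht : Tendsto collapse (f : Filter (Disconnection S)) (𝓝 t) := ht
  have htri : ∀ᶠ x : Disconnection S in f, (x.collapse < t ∨ x.collapse = t) ∨ t < x.collapse :=
    Eventually.of_forall fun x => by rw [or_assoc]; exact lt_trichotomy _ _
  rw [Ultrafilter.eventually_or, Ultrafilter.eventually_or] at htri
  rcases htri with (h | h) | h
  · exact ⟨_, mem_univ _, tendsto_ptOver_false (f := id) (tendsto_nhdsWithin_iff.2 ⟨ht, h⟩)⟩
  · have h' : ∀ᶠ x : Disconnection S in f, x = ptOver S t false ∨ x = ptOver S t true := by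
      filter_upwards [h] with x hx
      rw [← hx]
      exact eq_ptOver x
    rw [Ultrafilter.eventually_or] at h'
    rcases h' with h' | h'
    · exact ⟨ptOver S t false, mem_univ _, (le_pure_iff.2 h').trans (pure_le_nhds _)⟩
    · exact ⟨ptOver S t true, mem_univ _, (le_pure_iff.2 h').trans (pure_le_nhds _)⟩
  · exact ⟨_, mem_univ _, tendsto_ptOver_true (f := id) (tendsto_nhdsWithin_iff.2 ⟨ht, h⟩)⟩

theorem eq_of_collapse_eq {x y : Disconnection S} (hx : x.collapse ∉ S \ {0, 1})
    (h : y.collapse = x.collapse) : y = x :=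
  calc y = ptOver S y.collapse false := eq_ptOver_of_notMem y (h ▸ hx) false
    _ = ptOver S x.collapse false := by rw [h]
    _ = x := (eq_ptOver_of_notMem x hx false).symm

theorem eq_ptOver_side (x : Disconnection S) :
    (x.collapse < 1 ∧ x = ptOver S x.collapse true) ∨
      (0 < x.collapse ∧ x = ptOver S x.collapse false) := by
  by_cases h0 : x.collapse = 0
  · exact Or.inl ⟨by simp [h0], eq_ptOver_of_notMem x (by simp [h0]) true⟩
  by_cases h1 : x.collapse = 1
  · exact Or.inr ⟨by simp [h1], eq_ptOver_of_notMem x (by simp [h1]) false⟩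
  rcases eq_ptOver x with h | h
  · exact Or.inr ⟨lt_of_le_of_ne unitInterval.nonneg' (Ne.symm h0), h⟩
  · exact Or.inl ⟨lt_of_le_of_ne unitInterval.le_one' h1, h⟩

theorem tendsto_ptOver_nhdsGT (t : unitInterval) (b : Bool) :
    Tendsto (fun s => ptOver S s b) (𝓝[>] t) (𝓝 (ptOver S t true)) :=
  tendsto_ptOver_true (by simp only [collapse_ptOver]; exact tendsto_id)

theorem tendsto_ptOver_nhdsLT (t : unitInterval) (b : Bool) :
    Tendsto (fun s => ptOver S s b) (𝓝[<] t) (𝓝 (ptOver S t false)) :=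
  tendsto_ptOver_false (by simp only [collapse_ptOver]; exact tendsto_id)

theorem nhdsNE_neBot (x : Disconnection S) : (𝓝[≠] x).NeBot := by
  have key : ∀ {l : Filter unitInterval}, l.NeBot → l ≤ 𝓟 {x.collapse}ᶜ →
      Tendsto (fun s => ptOver S s false) l (𝓝 x) → (𝓝[≠] x).NeBot := by
    intro l hl hlx h
    refine (tendsto_nhdsWithin_iff.2 ⟨h, ?_⟩ : Tendsto _ l (𝓝[≠] x)).neBot
    filter_upwards [hlx (mem_principal_self _)] with s hs hsx
    exact hs (by rw [mem_singleton_iff, ← hsx, collapse_ptOver])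
  rcases eq_ptOver_side x with ⟨hx, h⟩ | ⟨hx, h⟩
  · refine key (MonotonicityPartition.neBot_right hx)
      (le_principal_iff.2 (mem_of_superset self_mem_nhdsWithin fun s hs => ne_of_gt hs)) ?_
    have hlim := tendsto_ptOver_nhdsGT (S := S) x.collapse false
    rwa [← h] at hlim
  · refine key (MonotonicityPartition.neBot_left hx)
      (le_principal_iff.2 (mem_of_superset self_mem_nhdsWithin fun s hs => ne_of_lt hs)) ?_
    have hlim := tendsto_ptOver_nhdsLT (S := S) x.collapse false
    rwa [← h] at hlim

theorem ptOver_false_lt_true {y : unitInterval} (h : y ∈ S \ {0, 1}) :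
    ptOver S y false < ptOver S y true := by
  change (ptOver S y false).1 < (ptOver S y true).1
  rw [ptOver_of_mem h, ptOver_of_mem h]
  exact Prod.Lex.lt_iff.2 (Or.inr ⟨rfl, Bool.false_lt_true⟩)

theorem ptOver_le_of_lt {y : unitInterval} {b : Bool} {x : Disconnection S} (h : y < x.collapse) :
    ptOver S y b ≤ x := (lt_of_collapse_lt (by simpa using h)).le

theorem le_ptOver_of_lt {y : unitInterval} {b : Bool} {x : Disconnection S} (h : x.collapse < y) :
    x ≤ ptOver S y b := (lt_of_collapse_lt (by simpa using h)).le

theorem le_collapse_of_ptOver_le {y : unitInterval} {b : Bool} {x : Disconnection S}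
    (h : ptOver S y b ≤ x) : y ≤ x.collapse := by simpa using collapse_mono h

theorem collapse_le_of_le_ptOver {y : unitInterval} {b : Bool} {x : Disconnection S}
    (h : x ≤ ptOver S y b) : x.collapse ≤ y := by simpa using collapse_mono h

/-- At a doubled point the order jumps, so the closed ray from y⁺ is the open ray from y⁻; for y = 0
it is the whole space. -/
theorem isOpen_Ici_ptOver {y : unitInterval} (hy : y ∈ S) (hy1 : y < 1) :
    IsOpen (Ici (ptOver S y true)) := by
  by_cases h0 : y = 0
  · have : Ici (ptOver S y true) = univ := by
      refine eq_univ_of_forall fun x => ?_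
      rw [mem_Ici, ptOver_eq_of_notMem (by simp [h0]) true false]
      by_contra hx
      have h1 : x.collapse = y := le_antisymm (collapse_le_of_le_ptOver (not_le.1 hx).le)
        (h0 ▸ unitInterval.nonneg')
      exact hx (h1 ▸ ptOver_false_le x)
    rw [this]; exact isOpen_univ
  · have : Ici (ptOver S y true) = Ioi (ptOver S y false) := by
      ext x
      refine ⟨fun h => (ptOver_false_lt_true ⟨hy, by simp [h0, hy1.ne]⟩).trans_le h, fun h => ?_⟩
      rcases (le_collapse_of_ptOver_le (le_of_lt h)).lt_or_eq with h' | h'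
      · exact ptOver_le_of_lt h'
      · subst h'
        rcases eq_ptOver x with hx | hx
        · exact absurd hx (ne_of_gt h)
        · exact hx.ge
    rw [this]; exact isOpen_Ioi

theorem isOpen_Iic_ptOver {y : unitInterval} (hy : y ∈ S) (hy0 : 0 < y) :
    IsOpen (Iic (ptOver S y false)) := by
  by_cases h1 : y = 1
  · have : Iic (ptOver S y false) = univ := by
      refine eq_univ_of_forall fun x => ?_
      rw [mem_Iic, ptOver_eq_of_notMem (by simp [h1]) false true]
      by_contra hx
      have h2 : x.collapse = y := le_antisymm (h1 ▸ unitInterval.le_one')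
        (le_collapse_of_ptOver_le (not_le.1 hx).le)
      exact hx (h2 ▸ le_ptOver_true x)
    rw [this]; exact isOpen_univ
  · have : Iic (ptOver S y false) = Iio (ptOver S y true) := by
      ext x
      refine ⟨fun h => lt_of_le_of_lt h (ptOver_false_lt_true ⟨hy, by simp [h1, hy0.ne']⟩),
        fun h => ?_⟩
      rcases (collapse_le_of_le_ptOver (le_of_lt h)).lt_or_eq with h' | h'
      · exact le_ptOver_of_lt h'
      · subst h'
        rcases eq_ptOver x with hx | hx
        · exact hx.le
        · exact absurd hx (ne_of_lt h)
    rw [this]; exact isOpen_Iio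

/-- By density U contains a point with a one-point fibre. The ends of an order interval around it
therefore collapse to points strictly on either side. -/
theorem exists_isOpen_preimage_subset (hS : S.Countable) (h0 : (0 : unitInterval) ∈ S)
    (h1 : (1 : unitInterval) ∈ S) {U : Set (Disconnection S)} (hU : IsOpen U) (hne : U.Nonempty) :
    ∃ U₀ : Set unitInterval, IsOpen U₀ ∧ U₀.Nonempty ∧ collapse ⁻¹' U₀ ⊆ U := by
  obtain ⟨x, hxU, hxS⟩ := (dense_preimage_compl hS).inter_open_nonempty U hU hne
  have hx0 : x.collapse ≠ 0 := fun h => hxS (h ▸ h0)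
  have hx1 : x.collapse ≠ 1 := fun h => hxS (h ▸ h1)
  have huniq : ∀ y : Disconnection S, y.collapse = x.collapse → y = x := fun y hy =>
    eq_of_collapse_eq (fun h => hxS h.1) hy
  obtain ⟨l, u, hlu, hsub⟩ := (mem_nhds_iff_exists_Ioo_subset'
    ⟨ptOver S 0 false, lt_of_collapse_lt
      (by simpa using lt_of_le_of_ne unitInterval.nonneg' hx0.symm)⟩
    ⟨ptOver S 1 false, lt_of_collapse_lt
      (by simpa using lt_of_le_of_ne unitInterval.le_one' hx1)⟩).1 (hU.mem_nhds hxU)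
  have hl : l.collapse < x.collapse := lt_of_le_of_ne (collapse_mono hlu.1.le) fun h =>
    hlu.1.ne (huniq l h)
  have hu : x.collapse < u.collapse := lt_of_le_of_ne (collapse_mono hlu.2.le) fun h =>
    hlu.2.ne (huniq u h.symm).symm
  exact ⟨Ioo l.collapse u.collapse, isOpen_Ioo, ⟨_, hl, hu⟩, fun y hy =>
    hsub ⟨lt_of_collapse_lt hy.1, lt_of_collapse_lt hy.2⟩⟩

end Disconnection

/-! ### The local homeomorphism in terms of one-sided limits. -/

namespace MonotonicityPartition

open Disconnection

variable {τ : unitInterval → unitInterval}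

theorem continuous_localHomeo (P : MonotonicityPartition τ) : Continuous P.localHomeo :=
  P.existsUnique_localHomeo.choose_spec.1.1

theorem collapse_localHomeo (P : MonotonicityPartition τ) {x : P.Space} (hx : x ∈ P.X₀) :
    (P.localHomeo x).collapse = τ x.collapse :=
  P.existsUnique_localHomeo.choose_spec.1.2 x hx

theorem zero_mem_genOrbit (P : MonotonicityPartition τ) : (0 : unitInterval) ∈ P.genOrbit :=
  P.C_subset P.zero_mem_C

theorem one_mem_genOrbit (P : MonotonicityPartition τ) : (1 : unitInterval) ∈ P.genOrbit :=
  P.C_subset P.one_mem_C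

theorem dense_compl_genOrbit (P : MonotonicityPartition τ) : Dense P.genOrbitᶜ :=
  dense_compl_of_countable P.countable_genOrbit

/-- Each point of X is approached by undoubled points from one side, where σ lies over τ; continuity
of σ identifies the image with the one-sided limit of τ. -/
theorem collapse_localHomeo_mem_hatMap (P : MonotonicityPartition τ) (x : P.Space) :
    (P.localHomeo x).collapse ∈ hatMap τ x.collapse := by
  have key : ∀ {l : Filter unitInterval} {v : unitInterval}, (l ⊓ 𝓟 P.genOrbitᶜ).NeBot →
      Tendsto (fun s => ptOver P.genOrbit s false) l (𝓝 x) → Tendsto τ l (𝓝 v) →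
      v = (P.localHomeo x).collapse := by
    intro l v hl hx hv
    refine tendsto_nhds_unique (hv.mono_left (inf_le_left (b := 𝓟 P.genOrbitᶜ)))
      (((continuous_collapse.comp P.continuous_localHomeo).continuousAt.tendsto.comp
        (hx.mono_left (inf_le_left (b := 𝓟 P.genOrbitᶜ)))).congr' ?_)
    filter_upwards [mem_inf_of_right (mem_principal_self P.genOrbitᶜ)] with s hs
    simpa using P.collapse_localHomeo (x := ptOver P.genOrbit s false) (by simpa [X₀] using hs)
  rcases eq_ptOver_side x with ⟨hx, h⟩ | ⟨hx, h⟩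
  · have hne := neBot_right hx
    obtain ⟨v, hv⟩ : ∃ v, Tendsto τ (𝓝[>] x.collapse) (𝓝 v) := by
      obtain ⟨v, hv | hv⟩ := P.exists_tendsto_right _ hx
      · exact ⟨v, hv.mono_right nhdsWithin_le_nhds⟩
      · exact ⟨v, hv.mono_right nhdsWithin_le_nhds⟩
    rw [← key (l := 𝓝[>] x.collapse) ?_ ?_ hv]
    · exact Or.inr ⟨hne, hv⟩
    · rw [inf_principal_neBot_iff]
      intro U hU
      obtain ⟨u, hu, hUu⟩ := (mem_nhdsGT_iff_exists_Ioo_subset' hx).1 hU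
      obtain ⟨s, hs, hs'⟩ := P.dense_compl_genOrbit.exists_between hu
      exact ⟨s, hUu hs', hs⟩
    · have hlim := tendsto_ptOver_nhdsGT (S := P.genOrbit) x.collapse false
      rwa [← h] at hlim
  · have hne := neBot_left hx
    obtain ⟨v, hv⟩ : ∃ v, Tendsto τ (𝓝[<] x.collapse) (𝓝 v) := by
      obtain ⟨v, hv | hv⟩ := P.exists_tendsto_left _ hx
      · exact ⟨v, hv.mono_right nhdsWithin_le_nhds⟩
      · exact ⟨v, hv.mono_right nhdsWithin_le_nhds⟩
    rw [← key (l := 𝓝[<] x.collapse) ?_ ?_ hv]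
    · exact Or.inl ⟨hne, hv⟩
    · rw [inf_principal_neBot_iff]
      intro U hU
      obtain ⟨u, hu, hUu⟩ := (mem_nhdsLT_iff_exists_Ioo_subset' hx).1 hU
      obtain ⟨s, hs, hs'⟩ := P.dense_compl_genOrbit.exists_between hu
      exact ⟨s, hUu hs', hs⟩
    · have hlim := tendsto_ptOver_nhdsLT (S := P.genOrbit) x.collapse false
      rwa [← h] at hlim

/-- The domain in `X` of the `i`-th branch of the local homeomorphism. -/
def branch (P : MonotonicityPartition τ) (i : Fin P.n) : Set P.Space :=
  Icc (ptOver P.genOrbit (P.a i.castSucc) true) (ptOver P.genOrbit (P.a i.succ) false)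

/-! ### Branches: clopen intervals mapped monotonically onto clopen intervals. -/

section Branch

variable (P : MonotonicityPartition τ) (i : Fin P.n)

theorem lt_succ : P.a i.castSucc < P.a i.succ := P.strictMono Fin.castSucc_lt_succ

theorem endpoint_mem (j : Fin (P.n + 1)) : P.a j ∈ P.genOrbit := P.C_subset ⟨j, rfl⟩

variable {i}

theorem notMem_C {t : unitInterval} (ht : t ∈ Ioo (P.a i.castSucc) (P.a i.succ)) : t ∉ P.C := by
  rintro ⟨j, rfl⟩
  have h1 := P.strictMono.lt_iff_lt.1 ht.1
  have h2 := P.strictMono.lt_iff_lt.1 ht.2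
  rw [Fin.lt_def] at h1 h2
  simp only [Fin.val_castSucc, Fin.val_succ] at h1 h2
  omega

theorem map_mem_genOrbit {t : unitInterval} (ht : t ∉ P.C) (htS : t ∈ P.genOrbit) :
    τ t ∈ P.genOrbit :=
  P.mem_of_mem_hatMap htS (by rw [P.hatMap_eq ht]; rfl)

variable (i)

theorem isOpen_branch : IsOpen (P.branch i) :=
  (isOpen_Ici_ptOver (P.endpoint_mem _) ((P.lt_succ i).trans_le unitInterval.le_one')).inter
    (isOpen_Iic_ptOver (P.endpoint_mem _) (unitInterval.nonneg'.trans_lt (P.lt_succ i)))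

theorem isClosed_branch : IsClosed (P.branch i) := isClosed_Icc

theorem exists_mem_branch (x : P.Space) : ∃ i, x ∈ P.branch i := by
  rcases eq_ptOver_side x with ⟨hx, h⟩ | ⟨hx, h⟩
  · obtain ⟨i, hi, hi'⟩ := P.exists_right _ hx
    refine ⟨i, ?_, le_ptOver_of_lt hi'⟩
    rcases hi.lt_or_eq with h' | h'
    · exact ptOver_le_of_lt h'
    · rw [h']; exact h.ge
  · obtain ⟨i, hi, hi'⟩ := P.exists_left _ hx
    refine ⟨i, ptOver_le_of_lt hi, ?_⟩
    rcases hi'.lt_or_eq with h' | h'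
    · exact le_ptOver_of_lt h'
    · rw [← h']; exact h.le

variable {i}

theorem mem_branch {x : P.Space} (hx : x.collapse ∈ Ioo (P.a i.castSucc) (P.a i.succ)) :
    x ∈ P.branch i := ⟨ptOver_le_of_lt hx.1, le_ptOver_of_lt hx.2⟩

theorem collapse_mem_Icc {x : P.Space} (hx : x ∈ P.branch i) :
    x.collapse ∈ Icc (P.a i.castSucc) (P.a i.succ) :=
  ⟨le_collapse_of_ptOver_le hx.1, collapse_le_of_le_ptOver hx.2⟩

theorem collapse_mem_Ioo {x : P.Space} (hx : x ∈ P.branch i) (hx₀ : x ∈ P.X₀) :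
    x.collapse ∈ Ioo (P.a i.castSucc) (P.a i.succ) :=
  ⟨lt_of_le_of_ne (P.collapse_mem_Icc hx).1 fun h => hx₀ (h ▸ P.endpoint_mem _),
    lt_of_le_of_ne (P.collapse_mem_Icc hx).2 fun h => hx₀ (h ▸ P.endpoint_mem _)⟩

theorem left_mem_branch : ptOver P.genOrbit (P.a i.castSucc) true ∈ P.branch i :=
  ⟨le_rfl, le_ptOver_of_lt (by simpa using P.lt_succ i)⟩

theorem right_mem_branch : ptOver P.genOrbit (P.a i.succ) false ∈ P.branch i :=
  ⟨ptOver_le_of_lt (by simpa using P.lt_succ i), le_rfl⟩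

/-- The tool for every estimate on σ: its values are given by τ only on X₀, but X₀ is dense in each
open set, so closed conditions extend. -/
theorem localHomeo_mem_of_dense {W K : Set P.Space} (hW : IsOpen W) (hK : IsClosed K)
    (h : ∀ z ∈ P.X₀, z ∈ W → P.localHomeo z ∈ K) {x : P.Space} (hx : x ∈ W) :
    P.localHomeo x ∈ K := by
  have h1 : closure (W ∩ P.X₀) ⊆ P.localHomeo ⁻¹' K :=
    closure_minimal (fun z hz => h z hz.2 hz.1) (hK.preimage P.continuous_localHomeo)
  exact h1 (P.dense_X₀.open_subset_closure_inter hW hx)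

/-- A doubled pair of points in a branch lies over an interior point of a monotonicity interval. -/
theorem exists_eq_ptOver_of_lt {x y : P.Space} (hx : x ∈ P.branch i) (hy : y ∈ P.branch i)
    (hxy : x < y) (hc : ¬ x.collapse < y.collapse) :
    ∃ t ∈ Ioo (P.a i.castSucc) (P.a i.succ), t ∈ P.genOrbit \ {0, 1} ∧
      x = ptOver P.genOrbit t false ∧ y = ptOver P.genOrbit t true := by
  have hc' : y.collapse = x.collapse := le_antisymm (not_lt.1 hc) (collapse_mono hxy.le)
  have hm : x.collapse ∈ P.genOrbit \ {0, 1} := by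
    by_contra hm
    exact hxy.ne' (eq_of_collapse_eq hm hc')
  have hlt := ptOver_false_lt_true hm
  have hx' : x = ptOver P.genOrbit x.collapse false := by
    rcases eq_ptOver x with h | h
    · exact h
    · exact absurd (le_ptOver_true y) (by rw [hc', ← h]; exact not_le.2 hxy)
  have hy' : y = ptOver P.genOrbit x.collapse true := by
    rcases eq_ptOver y with h | h
    · exact absurd (ptOver_false_le x) (by rw [← hc', ← h]; exact not_le.2 hxy)
    · rwa [hc'] at h
  refine ⟨x.collapse, ⟨lt_of_le_of_ne (P.collapse_mem_Icc hx).1 fun h => ?_,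
    lt_of_le_of_ne (P.collapse_mem_Icc hx).2 fun h => ?_⟩, hm, hx', hy'⟩
  · have := hx.1
    rw [h] at this
    exact absurd (hx' ▸ this) (by simpa using hlt)
  · have := hy.2
    rw [← h, hy'] at this
    exact absurd this (by simpa using hlt)

/-- If the branch maps into a clopen interval and no smaller one, it maps onto it. -/
theorem image_branch_eq {v w : unitInterval} (hv : v ∈ P.genOrbit) (hw : w ∈ P.genOrbit)
    (hv1 : v < 1) (hw0 : 0 < w)
    (hmaps : ∀ t ∈ Ioo (P.a i.castSucc) (P.a i.succ), τ t ∈ Ioo v w)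
    (hbot : ∃ x ∈ P.branch i, (P.localHomeo x).collapse = v)
    (htop : ∃ x ∈ P.branch i, (P.localHomeo x).collapse = w) :
    P.localHomeo '' P.branch i = Icc (ptOver P.genOrbit v true) (ptOver P.genOrbit w false) := by
  apply subset_antisymm
  · rintro _ ⟨x, hx, rfl⟩
    refine P.localHomeo_mem_of_dense (P.isOpen_branch i) isClosed_Icc (fun z hz hzi => ?_) hx
    have h := hmaps _ (P.collapse_mem_Ioo hzi hz)
    rw [← P.collapse_localHomeo hz] at h
    exact ⟨ptOver_le_of_lt h.1, le_ptOver_of_lt h.2⟩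
  · have hopen : IsOpen (Icc (ptOver P.genOrbit v true) (ptOver P.genOrbit w false)) :=
      (isOpen_Ici_ptOver hv hv1).inter (isOpen_Iic_ptOver hw hw0)
    refine (P.dense_X₀.open_subset_closure_inter hopen).trans (closure_minimal ?_
      ((P.isClosed_branch i).isCompact.image P.continuous_localHomeo).isClosed)
    rintro z ⟨hz, hz₀⟩
    have hzv : v < z.collapse := lt_of_le_of_ne (le_collapse_of_ptOver_le hz.1)
      fun h => hz₀ (h ▸ hv)
    have hzw : z.collapse < w := lt_of_le_of_ne (collapse_le_of_le_ptOver hz.2)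
      fun h => hz₀ (h ▸ hw)
    -- If τ never went below z on the interval, neither would σ on the branch by density,
    -- contradicting `hbot`.
    obtain ⟨s, hs, hsz⟩ : ∃ s ∈ Ioo (P.a i.castSucc) (P.a i.succ), τ s < z.collapse := by
      by_contra! h
      obtain ⟨x, hx, hxv⟩ := hbot
      have := P.localHomeo_mem_of_dense (P.isOpen_branch i)
        (isClosed_Ici.preimage continuous_collapse (t := Ici z.collapse))
        (fun z' hz' hzi => by
          rw [mem_preimage, P.collapse_localHomeo hz']
          exact h _ (P.collapse_mem_Ioo hzi hz')) hx
      rw [mem_preimage, hxv] at this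
      exact absurd hzv (not_lt.2 this)
    obtain ⟨s', hs', hsz'⟩ : ∃ s ∈ Ioo (P.a i.castSucc) (P.a i.succ), z.collapse < τ s := by
      by_contra! h
      obtain ⟨x, hx, hxw⟩ := htop
      have := P.localHomeo_mem_of_dense (P.isOpen_branch i)
        (isClosed_Iic.preimage continuous_collapse (t := Iic z.collapse))
        (fun z' hz' hzi => by
          rw [mem_preimage, P.collapse_localHomeo hz']
          exact h _ (P.collapse_mem_Ioo hzi hz')) hx
      rw [mem_preimage, hxw] at this
      exact absurd hzw (not_lt.2 this)
    -- The intermediate value theorem gives t with τ(t) = π(z). Since z is undoubled, t is too, and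
    -- σ sends the point over t to z itself.
    have hconn := (isPreconnected_Ioo.image τ (P.continuousOn i)).ordConnected
    obtain ⟨t, ht, htz⟩ := hconn.out (mem_image_of_mem τ hs) (mem_image_of_mem τ hs')
      ⟨hsz.le, hsz'.le⟩
    have ht₀ : t ∉ P.genOrbit := fun h => hz₀ (htz ▸ P.map_mem_genOrbit (P.notMem_C ht) h)
    have htX : ptOver P.genOrbit t false ∈ P.X₀ := by simpa [X₀] using ht₀
    have hcol : (P.localHomeo (ptOver P.genOrbit t false)).collapse = z.collapse := by
      rw [P.collapse_localHomeo htX, collapse_ptOver, htz]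
    exact ⟨ptOver P.genOrbit t false, P.mem_branch (by simpa using ht),
      eq_of_collapse_eq (fun h => hz₀ h.1) hcol⟩

/-- Density yields only a weak inequality; comparing with an intermediate s' first makes it strict.
-/
theorem collapse_localHomeo_lt_of_strictMonoOn
    (h : StrictMonoOn τ (Ioo (P.a i.castSucc) (P.a i.succ))) {x : P.Space} (hx : x ∈ P.branch i)
    {s : unitInterval} (hs : s ∈ Ioo (P.a i.castSucc) (P.a i.succ)) (hxs : x.collapse < s) :
    (P.localHomeo x).collapse < τ s := by
  obtain ⟨s', hs1, hs2⟩ := exists_between hxs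
  have hs' : s' ∈ Ioo (P.a i.castSucc) (P.a i.succ) :=
    ⟨(P.collapse_mem_Icc hx).1.trans_lt hs1, hs2.trans hs.2⟩
  have hle := P.localHomeo_mem_of_dense
    (W := P.branch i ∩ Iio (ptOver P.genOrbit s' false)) (K := collapse ⁻¹' Iic (τ s'))
    ((P.isOpen_branch i).inter isOpen_Iio) (isClosed_Iic.preimage continuous_collapse)
    (fun z hz hzW => by
      rw [mem_preimage, P.collapse_localHomeo hz]
      exact h.monotoneOn (P.collapse_mem_Ioo hzW.1 hz) hs' (collapse_le_of_le_ptOver hzW.2.le))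
    ⟨hx, lt_of_collapse_lt (by simpa using hs1)⟩
  exact hle.trans_lt (h hs' hs hs2)

theorem collapse_localHomeo_gt_of_strictMonoOn
    (h : StrictMonoOn τ (Ioo (P.a i.castSucc) (P.a i.succ))) {x : P.Space} (hx : x ∈ P.branch i)
    {s : unitInterval} (hs : s ∈ Ioo (P.a i.castSucc) (P.a i.succ)) (hxs : s < x.collapse) :
    τ s < (P.localHomeo x).collapse := by
  obtain ⟨s', hs1, hs2⟩ := exists_between hxs
  have hs' : s' ∈ Ioo (P.a i.castSucc) (P.a i.succ) :=
    ⟨hs.1.trans hs1, hs2.trans_le (P.collapse_mem_Icc hx).2⟩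
  have hle := P.localHomeo_mem_of_dense
    (W := P.branch i ∩ Ioi (ptOver P.genOrbit s' false)) (K := collapse ⁻¹' Ici (τ s'))
    ((P.isOpen_branch i).inter isOpen_Ioi) (isClosed_Ici.preimage continuous_collapse)
    (fun z hz hzW => by
      rw [mem_preimage, P.collapse_localHomeo hz]
      exact h.monotoneOn hs' (P.collapse_mem_Ioo hzW.1 hz) (le_collapse_of_ptOver_le hzW.2.le))
    ⟨hx, lt_of_collapse_lt (by simpa using hs2)⟩
  exact (h hs hs' hs1).trans_le hle

/-- The open ray below t⁺ is a neighbourhood of t⁻ whose undoubled points lie strictly left of t, so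
only the left side matters. -/
theorem localHomeo_ptOver_false_of_strictMonoOn
    (h : StrictMonoOn τ (Ioo (P.a i.castSucc) (P.a i.succ))) {t : unitInterval}
    (ht : t ∈ Ioo (P.a i.castSucc) (P.a i.succ)) (htS : t ∈ P.genOrbit \ {0, 1}) :
    P.localHomeo (ptOver P.genOrbit t false) ≤ ptOver P.genOrbit (τ t) false := by
  refine P.localHomeo_mem_of_dense
    (W := P.branch i ∩ Iio (ptOver P.genOrbit t true)) (K := Iic (ptOver P.genOrbit (τ t) false))
    ((P.isOpen_branch i).inter isOpen_Iio) isClosed_Iic (fun z hz hzW => ?_)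
    ⟨P.mem_branch (by simpa using ht), ptOver_false_lt_true htS⟩
  refine le_ptOver_of_lt ?_
  rw [P.collapse_localHomeo hz]
  exact h (P.collapse_mem_Ioo hzW.1 hz) ht
    (lt_of_le_of_ne (collapse_le_of_le_ptOver hzW.2.le) fun hzt => hz (hzt ▸ htS.1))

theorem localHomeo_ptOver_true_of_strictMonoOn
    (h : StrictMonoOn τ (Ioo (P.a i.castSucc) (P.a i.succ))) {t : unitInterval}
    (ht : t ∈ Ioo (P.a i.castSucc) (P.a i.succ)) (htS : t ∈ P.genOrbit \ {0, 1}) :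
    ptOver P.genOrbit (τ t) true ≤ P.localHomeo (ptOver P.genOrbit t true) := by
  refine P.localHomeo_mem_of_dense
    (W := P.branch i ∩ Ioi (ptOver P.genOrbit t false)) (K := Ici (ptOver P.genOrbit (τ t) true))
    ((P.isOpen_branch i).inter isOpen_Ioi) isClosed_Ici (fun z hz hzW => ?_)
    ⟨P.mem_branch (by simpa using ht), ptOver_false_lt_true htS⟩
  refine ptOver_le_of_lt ?_
  rw [P.collapse_localHomeo hz]
  exact h ht (P.collapse_mem_Ioo hzW.1 hz)
    (lt_of_le_of_ne (le_collapse_of_ptOver_le hzW.2.le) fun hzt => hz (hzt ▸ htS.1))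

theorem localHomeo_strictMonoOn (h : StrictMonoOn τ (Ioo (P.a i.castSucc) (P.a i.succ))) :
    StrictMonoOn P.localHomeo (P.branch i) := by
  intro x hx y hy hxy
  by_cases hc : x.collapse < y.collapse
  · obtain ⟨s, hs1, hs2⟩ := exists_between hc
    have hs : s ∈ Ioo (P.a i.castSucc) (P.a i.succ) :=
      ⟨(P.collapse_mem_Icc hx).1.trans_lt hs1, hs2.trans_le (P.collapse_mem_Icc hy).2⟩
    exact lt_of_collapse_lt ((P.collapse_localHomeo_lt_of_strictMonoOn h hx hs hs1).trans
      (P.collapse_localHomeo_gt_of_strictMonoOn h hy hs hs2))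
  -- The remaining case is x = t⁻, y = t⁺. Then τ(t) is doubled as well: it lies in I₁ and strictly
  -- between two other values of τ, so it is neither 0 nor 1.
  · obtain ⟨t, ht, htS, rfl, rfl⟩ := P.exists_eq_ptOver_of_lt hx hy hxy hc
    obtain ⟨s, hs, hst⟩ := exists_between ht.1
    obtain ⟨s', hts', hs'⟩ := exists_between ht.2
    have h1 := h ⟨hs, hst.trans ht.2⟩ ht hst
    have h2 := h ht ⟨ht.1.trans hts', hs'⟩ hts'
    have hτ : τ t ∈ P.genOrbit \ {0, 1} := by
      refine ⟨P.map_mem_genOrbit (P.notMem_C ht) htS.1, ?_⟩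
      rintro (h0 | h0)
      · rw [h0] at h1
        exact absurd h1 (not_lt.2 unitInterval.nonneg')
      · rw [h0] at h2
        exact absurd h2 (not_lt.2 unitInterval.le_one')
    exact (P.localHomeo_ptOver_false_of_strictMonoOn h ht htS).trans_lt
      ((ptOver_false_lt_true hτ).trans_le (P.localHomeo_ptOver_true_of_strictMonoOn h ht htS))

theorem collapse_localHomeo_gt_of_strictAntiOn
    (h : StrictAntiOn τ (Ioo (P.a i.castSucc) (P.a i.succ))) {x : P.Space} (hx : x ∈ P.branch i)
    {s : unitInterval} (hs : s ∈ Ioo (P.a i.castSucc) (P.a i.succ)) (hxs : x.collapse < s) :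
    τ s < (P.localHomeo x).collapse := by
  obtain ⟨s', hs1, hs2⟩ := exists_between hxs
  have hs' : s' ∈ Ioo (P.a i.castSucc) (P.a i.succ) :=
    ⟨(P.collapse_mem_Icc hx).1.trans_lt hs1, hs2.trans hs.2⟩
  have hle := P.localHomeo_mem_of_dense
    (W := P.branch i ∩ Iio (ptOver P.genOrbit s' false)) (K := collapse ⁻¹' Ici (τ s'))
    ((P.isOpen_branch i).inter isOpen_Iio) (isClosed_Ici.preimage continuous_collapse)
    (fun z hz hzW => by
      rw [mem_preimage, P.collapse_localHomeo hz]
      exact h.antitoneOn (P.collapse_mem_Ioo hzW.1 hz) hs' (collapse_le_of_le_ptOver hzW.2.le))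
    ⟨hx, lt_of_collapse_lt (by simpa using hs1)⟩
  exact (h hs' hs hs2).trans_le hle

theorem collapse_localHomeo_lt_of_strictAntiOn
    (h : StrictAntiOn τ (Ioo (P.a i.castSucc) (P.a i.succ))) {x : P.Space} (hx : x ∈ P.branch i)
    {s : unitInterval} (hs : s ∈ Ioo (P.a i.castSucc) (P.a i.succ)) (hxs : s < x.collapse) :
    (P.localHomeo x).collapse < τ s := by
  obtain ⟨s', hs1, hs2⟩ := exists_between hxs
  have hs' : s' ∈ Ioo (P.a i.castSucc) (P.a i.succ) :=
    ⟨hs.1.trans hs1, hs2.trans_le (P.collapse_mem_Icc hx).2⟩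
  have hle := P.localHomeo_mem_of_dense
    (W := P.branch i ∩ Ioi (ptOver P.genOrbit s' false)) (K := collapse ⁻¹' Iic (τ s'))
    ((P.isOpen_branch i).inter isOpen_Ioi) (isClosed_Iic.preimage continuous_collapse)
    (fun z hz hzW => by
      rw [mem_preimage, P.collapse_localHomeo hz]
      exact h.antitoneOn hs' (P.collapse_mem_Ioo hzW.1 hz) (le_collapse_of_ptOver_le hzW.2.le))
    ⟨hx, lt_of_collapse_lt (by simpa using hs2)⟩
  exact hle.trans_lt (h hs hs' hs1)

theorem localHomeo_ptOver_false_of_strictAntiOn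
    (h : StrictAntiOn τ (Ioo (P.a i.castSucc) (P.a i.succ))) {t : unitInterval}
    (ht : t ∈ Ioo (P.a i.castSucc) (P.a i.succ)) (htS : t ∈ P.genOrbit \ {0, 1}) :
    ptOver P.genOrbit (τ t) true ≤ P.localHomeo (ptOver P.genOrbit t false) := by
  refine P.localHomeo_mem_of_dense
    (W := P.branch i ∩ Iio (ptOver P.genOrbit t true)) (K := Ici (ptOver P.genOrbit (τ t) true))
    ((P.isOpen_branch i).inter isOpen_Iio) isClosed_Ici (fun z hz hzW => ?_)
    ⟨P.mem_branch (by simpa using ht), ptOver_false_lt_true htS⟩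
  refine ptOver_le_of_lt ?_
  rw [P.collapse_localHomeo hz]
  exact h (P.collapse_mem_Ioo hzW.1 hz) ht
    (lt_of_le_of_ne (collapse_le_of_le_ptOver hzW.2.le) fun hzt => hz (hzt ▸ htS.1))

theorem localHomeo_ptOver_true_of_strictAntiOn
    (h : StrictAntiOn τ (Ioo (P.a i.castSucc) (P.a i.succ))) {t : unitInterval}
    (ht : t ∈ Ioo (P.a i.castSucc) (P.a i.succ)) (htS : t ∈ P.genOrbit \ {0, 1}) :
    P.localHomeo (ptOver P.genOrbit t true) ≤ ptOver P.genOrbit (τ t) false := by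
  refine P.localHomeo_mem_of_dense
    (W := P.branch i ∩ Ioi (ptOver P.genOrbit t false)) (K := Iic (ptOver P.genOrbit (τ t) false))
    ((P.isOpen_branch i).inter isOpen_Ioi) isClosed_Iic (fun z hz hzW => ?_)
    ⟨P.mem_branch (by simpa using ht), ptOver_false_lt_true htS⟩
  refine le_ptOver_of_lt ?_
  rw [P.collapse_localHomeo hz]
  exact h ht (P.collapse_mem_Ioo hzW.1 hz)
    (lt_of_le_of_ne (le_collapse_of_ptOver_le hzW.2.le) fun hzt => hz (hzt ▸ htS.1))

theorem localHomeo_strictAntiOn (h : StrictAntiOn τ (Ioo (P.a i.castSucc) (P.a i.succ))) :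
    StrictAntiOn P.localHomeo (P.branch i) := by
  intro x hx y hy hxy
  by_cases hc : x.collapse < y.collapse
  · obtain ⟨s, hs1, hs2⟩ := exists_between hc
    have hs : s ∈ Ioo (P.a i.castSucc) (P.a i.succ) :=
      ⟨(P.collapse_mem_Icc hx).1.trans_lt hs1, hs2.trans_le (P.collapse_mem_Icc hy).2⟩
    exact lt_of_collapse_lt ((P.collapse_localHomeo_lt_of_strictAntiOn h hy hs hs2).trans
      (P.collapse_localHomeo_gt_of_strictAntiOn h hx hs hs1))
  · obtain ⟨t, ht, htS, rfl, rfl⟩ := P.exists_eq_ptOver_of_lt hx hy hxy hc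
    obtain ⟨s, hs, hst⟩ := exists_between ht.1
    obtain ⟨s', hts', hs'⟩ := exists_between ht.2
    have h1 := h ⟨hs, hst.trans ht.2⟩ ht hst
    have h2 := h ht ⟨ht.1.trans hts', hs'⟩ hts'
    have hτ : τ t ∈ P.genOrbit \ {0, 1} := by
      refine ⟨P.map_mem_genOrbit (P.notMem_C ht) htS.1, ?_⟩
      rintro (h0 | h0)
      · rw [h0] at h2
        exact absurd h2 (not_lt.2 unitInterval.nonneg')
      · rw [h0] at h1
        exact absurd h1 (not_lt.2 unitInterval.le_one')
    exact (P.localHomeo_ptOver_true_of_strictAntiOn h ht htS).trans_lt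
      ((ptOver_false_lt_true hτ).trans_le (P.localHomeo_ptOver_false_of_strictAntiOn h ht htS))

variable (i)

theorem localHomeo_strictMonoOn_or_strictAntiOn :
    StrictMonoOn P.localHomeo (P.branch i) ∨ StrictAntiOn P.localHomeo (P.branch i) :=
  (P.monotonic i).imp P.localHomeo_strictMonoOn P.localHomeo_strictAntiOn

/-- The ends of a branch lie over C, so their images lie over I₁ by closure under τ̂. Hence the
image is an interval cut at both ends at points of I₁, which makes it open. -/
theorem isOpen_ordConnected_image_branch :
    IsOpen (P.localHomeo '' P.branch i) ∧ (P.localHomeo '' P.branch i).OrdConnected := by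
  set p := ptOver P.genOrbit (P.a i.castSucc) true with hp
  set q := ptOver P.genOrbit (P.a i.succ) false with hq
  have hpS : (P.localHomeo p).collapse ∈ P.genOrbit := by
    refine P.mem_of_mem_hatMap ?_ (P.collapse_localHomeo_mem_hatMap p)
    simpa [hp] using P.endpoint_mem _
  have hqS : (P.localHomeo q).collapse ∈ P.genOrbit := by
    refine P.mem_of_mem_hatMap ?_ (P.collapse_localHomeo_mem_hatMap q)
    simpa [hq] using P.endpoint_mem _
  obtain ⟨s, hs⟩ := exists_between (P.lt_succ i)
  have key : ∀ {v w : unitInterval}, v ∈ P.genOrbit → w ∈ P.genOrbit →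
      (∀ t ∈ Ioo (P.a i.castSucc) (P.a i.succ), τ t ∈ Ioo v w) →
      (∃ x ∈ P.branch i, (P.localHomeo x).collapse = v) →
      (∃ x ∈ P.branch i, (P.localHomeo x).collapse = w) →
      IsOpen (P.localHomeo '' P.branch i) ∧ (P.localHomeo '' P.branch i).OrdConnected := by
    intro v w hv hw hmaps hbot htop
    have hv1 := (hmaps s hs).1.trans_le unitInterval.le_one'
    have hw0 := unitInterval.nonneg'.trans_lt (hmaps s hs).2
    rw [P.image_branch_eq hv hw hv1 hw0 hmaps hbot htop]
    exact ⟨(isOpen_Ici_ptOver hv hv1).inter (isOpen_Iic_ptOver hw hw0), ordConnected_Icc⟩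
  rcases P.monotonic i with h | h
  · refine key hpS hqS (fun t ht => ⟨?_, ?_⟩) ⟨p, P.left_mem_branch, rfl⟩
      ⟨q, P.right_mem_branch, rfl⟩
    · exact P.collapse_localHomeo_lt_of_strictMonoOn h P.left_mem_branch ht (by simpa using ht.1)
    · exact P.collapse_localHomeo_gt_of_strictMonoOn h P.right_mem_branch ht (by simpa using ht.2)
  · refine key hqS hpS (fun t ht => ⟨?_, ?_⟩) ⟨q, P.right_mem_branch, rfl⟩
      ⟨p, P.left_mem_branch, rfl⟩
    · exact P.collapse_localHomeo_lt_of_strictAntiOn h P.right_mem_branch ht (by simpa using ht.2)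
    · exact P.collapse_localHomeo_gt_of_strictAntiOn h P.left_mem_branch ht (by simpa using ht.1)

end Branch

/-! ### Passing between the interval map and the local homeomorphism. -/

theorem isOpenMap_localHomeo (P : MonotonicityPartition τ) : IsOpenMap P.localHomeo :=
  IsOpenMap.of_finite_cover P.continuous_localHomeo P.exists_mem_branch P.isClosed_branch
    (fun i => (P.localHomeo_strictMonoOn_or_strictAntiOn i).elim StrictMonoOn.injOn
      StrictAntiOn.injOn) fun i => (P.isOpen_ordConnected_image_branch i).1

theorem topStronglyTransitive_of_topTransitive (P : MonotonicityPartition τ)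
    (h : TopTransitive P.localHomeo) : TopStronglyTransitive P.localHomeo :=
  h.topStronglyTransitive P.continuous_localHomeo P.isOpenMap_localHomeo nhdsNE_neBot
    P.exists_mem_branch P.isOpen_branch P.localHomeo_strictMonoOn_or_strictAntiOn
    fun i => (P.isOpen_ordConnected_image_branch i).2

theorem mapsTo_localHomeo_X₀ (P : MonotonicityPartition τ) : MapsTo P.localHomeo P.X₀ P.X₀ := by
  intro x hx
  have h : (P.localHomeo x).collapse ∉ P.genOrbit := by
    rw [P.collapse_localHomeo hx]
    exact P.map_notMem hx
  exact h

theorem collapse_localHomeo_iterate (P : MonotonicityPartition τ) {x : P.Space} (hx : x ∈ P.X₀)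
    (n : ℕ) : (P.localHomeo^[n] x).collapse = τ^[n] x.collapse := by
  induction n with
  | zero => rfl
  | succ n ih =>
    rw [Function.iterate_succ_apply', Function.iterate_succ_apply',
      P.collapse_localHomeo (P.mapsTo_localHomeo_X₀.iterate n hx), ih]

/-- Off C the map τ is continuous, so a visit to V pulls back step by step to an open condition on
the starting point, which can then be moved off the countable set I₁. -/
theorem exists_iterate_mem (P : MonotonicityPartition τ) {U : Set unitInterval} (hU : IsOpen U)
    (n : ℕ) {V : Set unitInterval} (hV : IsOpen V) (h : (P.imageOff^[n] U ∩ V).Nonempty) :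
    ∃ x ∈ U, x ∉ P.genOrbit ∧ τ^[n] x ∈ V := by
  induction n generalizing V with
  | zero =>
    obtain ⟨x, hx, hxS⟩ := P.dense_compl_genOrbit.inter_open_nonempty _ (hU.inter hV) h
    exact ⟨x, hx.1, hxS, hx.2⟩
  | succ n ih =>
    rw [Function.iterate_succ_apply'] at h
    obtain ⟨_, ⟨w, ⟨hw, hwC⟩, rfl⟩, hwV⟩ := h
    have hnhds := (P.continuousAt hwC).preimage_mem_nhds (hV.mem_nhds hwV)
    obtain ⟨x, hxU, hxS, hx⟩ := ih isOpen_interior ⟨w, hw, mem_interior_iff_mem_nhds.2 hnhds⟩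
    refine ⟨x, hxU, hxS, ?_⟩
    rw [Function.iterate_succ_apply']
    exact interior_subset (s := τ ⁻¹' V) hx

theorem Transitive.topTransitive {P : MonotonicityPartition τ} (h : P.Transitive) :
    TopTransitive P.localHomeo := by
  intro U V hU hUne hV hVne
  obtain ⟨U₀, hU₀, hU₀ne, hUU⟩ := exists_isOpen_preimage_subset P.countable_genOrbit
    P.zero_mem_genOrbit P.one_mem_genOrbit hU hUne
  obtain ⟨V₀, hV₀, hV₀ne, hVV⟩ := exists_isOpen_preimage_subset P.countable_genOrbit
    P.zero_mem_genOrbit P.one_mem_genOrbit hV hVne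
  obtain ⟨n, hn⟩ := h U₀ V₀ hU₀ hU₀ne hV₀ hV₀ne
  obtain ⟨x, hxU, hxS, hxV⟩ := P.exists_iterate_mem hU₀ n hV₀ hn
  refine ⟨n, _, mem_image_of_mem _ (hUU (a := ptOver P.genOrbit x false) ?_), hVV ?_⟩
  · simpa using hxU
  · rw [mem_preimage, P.collapse_localHomeo_iterate (by simpa [X₀] using hxS), collapse_ptOver]
    exact hxV

theorem hatStronglyTransitive_of_topStronglyTransitive (P : MonotonicityPartition τ)
    (h : TopStronglyTransitive P.localHomeo) : HatStronglyTransitive τ := by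
  intro U hU hUne
  obtain ⟨u, hu⟩ := hUne
  obtain ⟨n, hn⟩ := h (collapse ⁻¹' U) (hU.preimage continuous_collapse)
    ⟨ptOver P.genOrbit u false, by simpa using hu⟩
  have key : ∀ k (x : P.Space), x.collapse ∈ U →
      (P.localHomeo^[k] x).collapse ∈ (hatImage τ)^[k] U := by
    intro k x hx
    induction k with
    | zero => exact hx
    | succ k ih =>
      rw [Function.iterate_succ_apply', Function.iterate_succ_apply']
      exact mem_iUnion₂.2 ⟨_, ih, P.collapse_localHomeo_mem_hatMap _⟩
  refine ⟨n, eq_univ_of_forall fun y => ?_⟩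
  have hy : ptOver P.genOrbit y false ∈ ⋃ k ≤ n, P.localHomeo^[k] '' (collapse ⁻¹' U) :=
    hn ▸ mem_univ _
  obtain ⟨k, hk, x, hx, hxy⟩ := mem_iUnion₂.1 hy
  refine mem_iUnion₂.2 ⟨k, hk, ?_⟩
  have := key k x hx
  rwa [hxy, collapse_ptOver] at this

theorem transitive_of_hatStronglyTransitive (P : MonotonicityPartition τ)
    (h : HatStronglyTransitive τ) : P.Transitive := by
  intro U V hU hUne hV hVne
  -- As I₁ is closed under τ̂, a τ̂-orbit ending outside I₁ never met I₁, hence never C, and so is a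
  -- genuine τ-orbit.
  have key : ∀ k, ∀ y ∉ P.genOrbit, y ∈ (hatImage τ)^[k] U → y ∈ P.imageOff^[k] U := by
    intro k
    induction k with
    | zero => exact fun y _ hy => hy
    | succ k ih =>
      intro y hyS hy
      rw [Function.iterate_succ_apply'] at hy ⊢
      obtain ⟨x, hx, hxy⟩ := mem_iUnion₂.1 hy
      have hxS : x ∉ P.genOrbit := fun hxS => hyS (P.mem_of_mem_hatMap hxS hxy)
      have hxC : x ∉ P.C := fun hxC => hxS (P.C_subset hxC)
      rw [P.hatMap_eq hxC] at hxy
      exact ⟨x, ⟨ih x hxS hx, hxC⟩, hxy.symm⟩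
  obtain ⟨n, hn⟩ := h U hU hUne
  obtain ⟨y, hyV, hyS⟩ := P.dense_compl_genOrbit.inter_open_nonempty V hV hVne
  have hy : y ∈ ⋃ k ≤ n, (hatImage τ)^[k] U := hn ▸ mem_univ y
  obtain ⟨k, -, hk⟩ := mem_iUnion₂.1 hy
  exact ⟨k, y, key k y hyS hk, hyV⟩

end MonotonicityPartition

theorem proposition1p8 (τ : unitInterval → unitInterval) (P : MonotonicityPartition τ) :
    List.TFAE [
      P.Transitive,
      HatStronglyTransitive τ,
      TopTransitive P.localHomeo,
      TopStronglyTransitive P.localHomeo] := by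
  tfae_have 1 → 3 := fun h => h.topTransitive
  tfae_have 3 → 4 := P.topStronglyTransitive_of_topTransitive
  tfae_have 4 → 2 := P.hatStronglyTransitive_of_topStronglyTransitive
  tfae_have 2 → 1 := P.transitive_of_hatStronglyTransitive
  tfae_finish
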